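/- Let $G$ be a real Lie group with Lie algebra $\mathfrak g$, let $H$ be a closed subgroup of $G$ with Lie algebra $\mathfrak h=\{X\in\mathfrak g:\exp(tX)\in H\text{ for all }t\in\mathbb R\}$, let $\mathfrak m$ be a linear subspace of $\mathfrak g$ complementary to $\mathfrak h$, and let $\chi$ be a continuous homomorphism from $H$ to $\mathbb C\setminus\{0\}$, whose differential (extended complex linearly to $\mathfrak h^{\mathbb C}$) is also denoted by $\chi$. Let $C^\infty(G)$ be the space of complex-valued smooth functions on $G$ and $$C^\infty_{H,\chi}(G)=\{f\in C^\infty(G): f(gh)=f(g)\chi(h^{-1})\text{ for all }g\in G,\ h\in H\}.$$ Let $\mathbb D(G)$ be the algebra of left invariant differential operators on $G$ with complex coefficients. Identify $X\in\mathfrak g$ with the left invariant vector field $\tilde X$, $(\tilde Xf)(g)=\frac{d}{dt}f(g\exp tX)|_{t=0}$, and extend $X\mapsto\tilde X$ complex linearly to $\mathfrak g^{\mathbb C}$. For $g\in G$ let $\mathrm{Ad}(g)$ also denote the extension of the automorphism $\mathrm{Ad}(g)$ of $\mathfrak g$ to an algebra automorphism of $\mathbb D(G)$. Put $$\mathfrak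 h^\chi=\{X+\chi(X):X\in\mathfrak h^{\mathbb C}\}\subset\mathbb D(G),$$ let $\mathbb D(G)\mathfrak h^\chi$ be the linear span of all $vw$ with $v\in\mathbb D(G)$, $w\in\mathfrak h^\chi$, and let $$\mathbb D_{H,\chi,\mathrm{mod}}(G)=\{D\in\mathbb D(G):\mathrm{Ad}(h)D-D\in\mathbb D(G)\mathfrak h^\chi\text{ for all }h\in H\}.$$ For a real vector space $V$ let $S(V)$ be its symmetric algebra with complex coefficients, and regard $S(\mathfrak m)$ as a subalgebra of $S(\mathfrak g)$. Let $\lambda:S(\mathfrak g)\to\mathbb D(G)$ be the symmetrization map, i.e. the linear map with $$\lambda(Y_1\cdots Y_m)=\frac1{m!}\sum_{s\in S_m}\tilde Y_{s(1)}\cdots\tilde Y_{s(m)}\qquad(Y_1,\dots,Y_m\in\mathfrak g).$$ Let $\sigma:\mathfrak g\to\mathfrak m$ be the projection along $\mathfrak h$, extend $\sigma$ and $\mathrm{Ad}(h)$ to algebra homomorphisms on $S(\mathfrak g)$, and let $$I_{\mathrm{mod}}(\mathfrak m)=\{P\in S(\mathfrak m):\sigma\circ\mathrm{Ad}(h)P=P\text{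 for all }h\in H\}.$$ Suppose that $\lambda(I_{\mathrm{mod}}(\mathfrak m))\subset\mathbb D_{H,\chi,\mathrm{mod}}(G)$. Then $$\lambda(I_{\mathrm{mod}}(\mathfrak m))=\lambda(S(\mathfrak m))\cap\mathbb D_{H,\chi,\mathrm{mod}}(G),$$ and the restriction map $D\mapsto D|_{C^\infty_{H,\chi}(G)}$ is a linear bijection from $\lambda(I_{\mathrm{mod}}(\mathfrak m))$ onto $\mathbb D_{H,\chi,\mathrm{mod}}(G)|_{C^\infty_{H,\chi}(G)}=\{D|_{C^\infty_{H,\chi}(G)}:D\in\mathbb D_{H,\chi,\mathrm{mod}}(G)\}$. -/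

import Mathlib

open scoped Manifold ContDiff TensorProduct Nat Topology

noncomputable section

set_option linter.unusedSectionVars false

/-! ### The complexified symmetric algebra and the symmetrization map -/

/-- `S(V)`, the symmetric algebra with complex coefficients of a real vector space `V`. -/
abbrev SymC (V : Type*) [AddCommGroup V] [Module ℝ V] : Type _ :=
  SymmetricAlgebra ℂ (ℂ ⊗[ℝ] V)

/-- The unique extension of a real linear map `T : V → W` to an algebra homomorphism
`S(V) → S(W)`. -/
def SymC.map {V W : Type*} [AddCommGroup V] [Module ℝ V] [AddCommGroup W] [Module ℝ W]
    (T : V →ₗ[ℝ] W) : SymC V →ₐ[ℂ] SymC W :=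
  SymmetricAlgebra.lift (SymmetricAlgebra.ι ℂ (ℂ ⊗[ℝ] W) ∘ₗ T.baseChange ℂ)

theorem SymC.map_ι {V W : Type*} [AddCommGroup V] [Module ℝ V] [AddCommGroup W] [Module ℝ W]
    (T : V →ₗ[ℝ] W) (v : V) :
    SymC.map T (SymmetricAlgebra.ι ℂ (ℂ ⊗[ℝ] V) (1 ⊗ₜ v)) =
      SymmetricAlgebra.ι ℂ (ℂ ⊗[ℝ] W) (1 ⊗ₜ T v) := by
  simp [SymC.map]

/-- `S(M)` as a subalgebra of `S(V)`, for a linear subspace `M` of `V`. -/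
def SymC.sub {V : Type*} [AddCommGroup V] [Module ℝ V] (M : Submodule ℝ V) :
    Subalgebra ℂ (SymC V) :=
  (SymC.map M.subtype).range

/-- The symmetrized product `(1/m!) ∑_σ a_{σ(1)} ⋯ a_{σ(m)}` in an associative algebra. -/
def symProd {A : Type*} [Ring A] [Algebra ℂ A] {m : ℕ} (a : Fin m → A) : A :=
  ((m ! : ℕ) : ℂ)⁻¹ • ∑ σ : Equiv.Perm (Fin m), (List.ofFn fun k => a (σ k)).prod

theorem symProd_comp_perm {A : Type*} [Ring A] [Algebra ℂ A] {m : ℕ} (a : Fin m → A)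
    (τ : Equiv.Perm (Fin m)) : symProd (a ∘ τ) = symProd a := by
  unfold symProd
  congr 1
  exact Fintype.sum_equiv (Equiv.mulLeft τ) _ _ (fun σ => rfl)

theorem symProd_eq_of_perm {A : Type*} [Ring A] [Algebra ℂ A] {κ : Type*} (j : κ → A) {m n : ℕ}
    (a : Fin m → κ) (b : Fin n → κ) (h : (List.ofFn a).Perm (List.ofFn b)) :
    symProd (fun k => j (a k)) = symProd (fun k => j (b k)) := by
  have hmn : m = n := by simpa using h.length_eq
  subst hmn
  have hm : Multiset.map a Finset.univ.val = Multiset.map b Finset.univ.val := by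
    rw [Fin.univ_val_map, Fin.univ_val_map]
    exact Quotient.sound h
  have hc : ∀ c : κ, Nonempty ({k // a k = c} ≃ {k // b k = c}) := by
    classical
    intro c
    refine ⟨Fintype.equivOfCardEq ?_⟩
    have := congrArg (Multiset.count c) hm
    rw [Multiset.count_map, Multiset.count_map] at this
    rw [Fintype.card_subtype, Fintype.card_subtype]
    simpa [Finset.card_def, Finset.filter_val, eq_comm] using this
  have key : (fun k => j (a k)) =
      (fun k => j (b k)) ∘ Equiv.ofFiberEquiv fun c => (hc c).some := by
    funext k
    simp only [Function.comp_apply, Equiv.ofFiberEquiv_map]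
  rw [key, symProd_comp_perm]

/-- Given a linear map `j` from a complex vector space `V` to an associative algebra `A`, the
linear map `S(V) → A` that sends `Y₁ ⋯ Y_m` to `(1/m!) ∑_σ j(Y_{σ(1)}) ⋯ j(Y_{σ(m)})`.
It is defined on the monomials in a basis of `V`; `symmetrization_prod` gives the formula for
arbitrary vectors, so that the choice of the basis is immaterial. -/
def symmetrization {V : Type*} [AddCommGroup V] [Module ℂ V] {A : Type*} [Ring A] [Algebra ℂ A]
    (j : V →ₗ[ℂ] A) : SymmetricAlgebra ℂ V →ₗ[ℂ] A :=
  (Module.Free.chooseBasis ℂ V).symmetricAlgebra.constr ℂ fun α =>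
    symProd fun k => j (Module.Free.chooseBasis ℂ V ((Finsupp.toMultiset α).toList.get k))

theorem symmetrization_prod {V : Type*} [AddCommGroup V] [Module ℂ V] {A : Type*} [Ring A]
    [Algebra ℂ A] (j : V →ₗ[ℂ] A) {m : ℕ} (Y : Fin m → V) :
    symmetrization j (∏ k, SymmetricAlgebra.ι ℂ V (Y k)) = symProd fun k => j (Y k) := by
  set b := Module.Free.chooseBasis ℂ V with hb
  let L : MultilinearMap ℂ (fun _ : Fin m => V) A :=
    (symmetrization j).compMultilinearMap
      ((MultilinearMap.mkPiAlgebra ℂ (Fin m) (SymmetricAlgebra ℂ V)).compLinearMap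
        fun _ => SymmetricAlgebra.ι ℂ V)
  let R : MultilinearMap ℂ (fun _ : Fin m => V) A :=
    ((m ! : ℕ) : ℂ)⁻¹ • ∑ σ : Equiv.Perm (Fin m),
      ((MultilinearMap.mkPiAlgebraFin ℂ m A).compLinearMap fun _ => j).domDomCongr σ
  have hR : ∀ Z, R Z = symProd fun k => j (Z k) := by
    intro Z
    simp [R, symProd]
  suffices L = R by
    have h := congrArg (fun F => F Y) this
    simpa [L, hR] using h
  refine Module.Basis.ext_multilinear (fun _ => b) fun i => ?_
  rw [hR]
  have h1 : L (fun k => b (i k)) =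
      symmetrization j (b.symmetricAlgebra (∑ k, Finsupp.single (i k) 1)) := by
    have h2 : b.symmetricAlgebra (∑ k, Finsupp.single (i k) 1) =
        ∏ k, SymmetricAlgebra.ι ℂ V (b (i k)) := by
      have h3 : b.symmetricAlgebra (∑ k, Finsupp.single (i k) 1) =
          (SymmetricAlgebra.equivMvPolynomial b).symm
            (MvPolynomial.monomial (∑ k, Finsupp.single (i k) 1) 1) := by
        simp [Module.Basis.symmetricAlgebra]
      have h4 : (MvPolynomial.monomial (∑ k, Finsupp.single (i k) 1) (1 : ℂ)) =
          ∏ k, MvPolynomial.X (i k) := by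
        exact MvPolynomial.monomial_sum_one Finset.univ fun k => Finsupp.single (i k) 1
      rw [h3, h4, map_prod]
      simp
    rw [h2]
    simp [L]
  rw [h1, symmetrization, Module.Basis.constr_basis]
  refine symProd_eq_of_perm (fun x => j (b x)) _ _ ?_
  rw [List.ofFn_get]
  refine Multiset.coe_eq_coe.mp ?_
  rw [Multiset.coe_toList, map_sum, ← Fin.univ_val_map]
  refine Eq.trans ?_ (Multiset.sum_map_singleton (Multiset.map i Finset.univ.val))
  simp only [Finsupp.toMultiset_single, one_smul, Finset.sum, Multiset.map_map,
    Function.comp_def]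

/-! ### Operators on the smooth functions on a Lie group -/

section LieGroupDefs

variable (E : Type*) [NormedAddCommGroup E] [NormedSpace ℝ E] [FiniteDimensional ℝ E]
  (G : Type*) [TopologicalSpace G] [ChartedSpace E G] [Group G] [LieGroup 𝓘(ℝ, E) ∞ G]

/-- The Lie algebra `𝔤` of `G`, i.e. the tangent space at the identity. -/
abbrev LieAlg : Type _ := GroupLieAlgebra 𝓘(ℝ, E) G

/-- The complex-valued smooth functions on `G`, as a subspace of all functions. -/
def smoothSubspace : Submodule ℂ (G → ℂ) where
  carrier := {f | ContMDiff 𝓘(ℝ, E) 𝓘(ℝ, ℂ) ∞ f}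
  add_mem' hf hg := hf.add hg
  zero_mem' := contMDiff_const
  smul_mem' c _ hf :=
    (contDiff_const.mul contDiff_id : ContDiff ℝ ∞ fun z : ℂ => c * z).contMDiff.comp hf

/-- `C^∞(G)`, the space of complex-valued smooth functions on `G`. -/
def SmoothFun : Type _ := smoothSubspace E G

instance : AddCommGroup (SmoothFun E G) := inferInstanceAs (AddCommGroup (smoothSubspace E G))

instance : Module ℂ (SmoothFun E G) := inferInstanceAs (Module ℂ (smoothSubspace E G))

/-- Linear operators on `C^∞(G)`. -/
abbrev Op : Type _ := Module.End ℂ (SmoothFun E G)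

variable {E G}

theorem SmoothFun.ext' {f f' : SmoothFun E G} (h : ∀ x, f.1 x = f'.1 x) : f = f' :=
  Subtype.ext (funext h)

/-- The operator `f ↦ f(g ·)` on `C^∞(G)`. -/
def leftTranslate (g : G) : Op E G where
  toFun f := ⟨fun x => f.1 (g * x), f.2.comp (contMDiff_mul_left (I := 𝓘(ℝ, E)) (a := g))⟩
  map_add' _ _ := rfl
  map_smul' _ _ := rfl

/-- The operator `f ↦ f^{R(g)} = f(· g)` on `C^∞(G)`. -/
def rightTranslate (g : G) : Op E G where
  toFun f := ⟨fun x => f.1 (x * g), f.2.comp (contMDiff_mul_right (I := 𝓘(ℝ, E)) (a := g))⟩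
  map_add' _ _ := rfl
  map_smul' _ _ := rfl

theorem rightTranslate_mul_inv (g : G) :
    (rightTranslate g * rightTranslate g⁻¹ : Op E G) = 1 := by
  refine LinearMap.ext fun f => SmoothFun.ext' fun x => ?_
  change f.1 (x * g * g⁻¹) = f.1 x
  rw [mul_inv_cancel_right]

/-- The partial derivative `∂_{i₁} ⋯ ∂_{i_k} f` at `y`, in the preferred chart at `x₀`. -/
def chartPartial (x₀ : G) {k : ℕ} (i : Fin k → Fin (Module.finrank ℝ E)) (f : SmoothFun E G)
    (y : G) : ℂ :=
  iteratedFDeriv ℝ k (fun v : E => f.1 ((chartAt E x₀).symm v)) (chartAt E x₀ y)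
    (fun l => Module.finBasis ℝ E (i l))

/-- `D` is a differential operator: near every point of `G` it is, in a chart, a finite sum
`∑ a_{i₁…i_k} ∂_{i₁} ⋯ ∂_{i_k}` with smooth complex-valued coefficients. -/
def IsDiffOp (D : Op E G) : Prop :=
  ∀ x₀ : G, ∃ U ∈ 𝓝 x₀, U ⊆ (chartAt E x₀).source ∧
    ∃ (N : ℕ) (a : (k : ℕ) → (Fin k → Fin (Module.finrank ℝ E)) → G → ℂ),
      (∀ k i, ContMDiffOn 𝓘(ℝ, E) 𝓘(ℝ, ℂ) ∞ (a k i) U) ∧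
      ∀ (f : SmoothFun E G), ∀ y ∈ U,
        (D f).1 y = ∑ k ∈ Finset.range N, ∑ i, a k i y * chartPartial x₀ i f y

theorem IsDiffOp.add {D D' : Op E G} (h : IsDiffOp D) (h' : IsDiffOp D') : IsDiffOp (D + D') := by
  intro x₀
  obtain ⟨U, hU, hUs, N, a, ha, hD⟩ := h x₀
  obtain ⟨U', hU', -, N', a', ha', hD'⟩ := h' x₀
  refine ⟨U ∩ U', Filter.inter_mem hU hU', fun y hy => hUs hy.1, max N N',
    fun k i y => (if k < N then a k i y else 0) + (if k < N' then a' k i y else 0), ?_, ?_⟩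
  · intro k i
    refine ContMDiffOn.add ?_ ?_
    · by_cases hk : k < N
      · simpa [hk] using (ha k i).mono Set.inter_subset_left
      · simpa [hk] using contMDiffOn_const
    · by_cases hk : k < N'
      · simpa [hk] using (ha' k i).mono Set.inter_subset_right
      · simpa [hk] using contMDiffOn_const
  · intro f y hy
    have key : ∀ (M : ℕ) (b : (k : ℕ) → (Fin k → Fin (Module.finrank ℝ E)) → G → ℂ),
        M ≤ max N N' → ∑ k ∈ Finset.range M, ∑ i, b k i y * chartPartial x₀ i f y =
          ∑ k ∈ Finset.range (max N N'), ∑ i, (if k < M then b k i y else 0) *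
            chartPartial x₀ i f y := by
      intro M b hM
      rw [← Finset.sum_subset (Finset.range_mono hM)]
      · refine Finset.sum_congr rfl fun k hk => ?_
        simp [Finset.mem_range.mp hk]
      · intro k _ hk
        have : ¬ k < M := by simpa using hk
        simp [this]
    have h1 : ((D + D') f).1 y = (D f).1 y + (D' f).1 y := rfl
    rw [h1, hD f y hy.1, hD' f y hy.2, key N a (le_max_left _ _), key N' a' (le_max_right _ _),
      ← Finset.sum_add_distrib]
    refine Finset.sum_congr rfl fun k _ => ?_
    rw [← Finset.sum_add_distrib]
    exact Finset.sum_congr rfl fun i _ => (add_mul _ _ _).symm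

theorem IsDiffOp.smul {D : Op E G} (c : ℂ) (h : IsDiffOp D) : IsDiffOp (c • D) := by
  intro x₀
  obtain ⟨U, hU, hUs, N, a, ha, hD⟩ := h x₀
  refine ⟨U, hU, hUs, N, fun k i y => c * a k i y,
    fun k i => (contDiff_const.mul contDiff_id :
      ContDiff ℝ ∞ fun z : ℂ => c * z).contMDiff.comp_contMDiffOn (ha k i), fun f y hy => ?_⟩
  have h1 : ((c • D) f).1 y = c * (D f).1 y := rfl
  simp only [h1, hD f y hy, Finset.mul_sum, mul_assoc]

variable (E G) in
/-- `𝔻(G)`, the left invariant differential operators on `G` with complex coefficients. -/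
def InvDiffOp : Submodule ℂ (Op E G) where
  carrier := {D | IsDiffOp D ∧ ∀ g : G, D * leftTranslate g = leftTranslate g * D}
  add_mem' h h' := ⟨h.1.add h'.1, fun g => by rw [add_mul, mul_add, h.2 g, h'.2 g]⟩
  zero_mem' := ⟨fun x₀ => ⟨(chartAt E x₀).source,
    (chartAt E x₀).open_source.mem_nhds (mem_chart_source E x₀), subset_rfl, 0, fun _ _ _ => 0,
    fun _ _ => contMDiffOn_const, fun _ _ _ => rfl⟩, fun g => by rw [zero_mul, mul_zero]⟩
  smul_mem' c _ h := ⟨h.1.smul c, fun g => by rw [smul_mul_assoc, mul_smul_comm, h.2 g]⟩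

theorem SmoothFun.hasMFDerivAt_mul (f : SmoothFun E G) (g : G) :
    HasMFDerivAt 𝓘(ℝ, E) 𝓘(ℝ, ℂ) (fun x => f.1 (g * x)) 1
      (mfderiv 𝓘(ℝ, E) 𝓘(ℝ, ℂ) (fun x => f.1 (g * x)) 1) :=
  (((leftTranslate g f).2.mdifferentiable (by simp)) 1).hasMFDerivAt

theorem contMDiff_leftInv (X : LieAlg E G) (f : SmoothFun E G) :
    ContMDiff 𝓘(ℝ, E) 𝓘(ℝ, ℂ) ∞
      (fun g : G => (mfderiv 𝓘(ℝ, E) 𝓘(ℝ, ℂ) (fun x => f.1 (g * x)) 1 X : ℂ)) := by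
  intro g₀
  have h1 : ContMDiff (𝓘(ℝ, E).prod 𝓘(ℝ, E)) 𝓘(ℝ, ℂ) ∞
      (Function.uncurry fun g x : G => f.1 (g * x)) :=
    f.2.comp (contMDiff_mul 𝓘(ℝ, E) ∞)
  have h2 := ContMDiffAt.mfderiv (x₀ := g₀) (m := ∞) (fun g x : G => f.1 (g * x)) (fun _ : G => (1 : G))
    (h1 (g₀, 1)) (contMDiffAt_const (I := 𝓘(ℝ, E))) (by simp)
  have h3 := h2.clm_apply (contMDiffAt_const (I' := 𝓘(ℝ, E)) (c := (show E from X)))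
  refine h3.congr_of_eventuallyEq (Filter.Eventually.of_forall fun g => ?_)
  have h4 := inTangentCoordinates_eq (I := 𝓘(ℝ, E)) (I' := 𝓘(ℝ, ℂ)) (fun _ : G => (1 : G))
    (fun g : G => f.1 (g * 1))
    (fun g : G => (mfderiv 𝓘(ℝ, E) 𝓘(ℝ, ℂ) (fun x => f.1 (g * x)) 1)) (x₀ := g₀) (x := g)
    (mem_chart_source E (1 : G))
    (by rw [chartAt_self_eq]; exact Set.mem_univ _)
  have h5 := congrArg (fun L : E →L[ℝ] ℂ => L X) h4
  refine Eq.trans ?_ h5.symm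
  have h6 : (tangentBundleCore 𝓘(ℝ, E) G).coordChange (achart E (1 : G)) (achart E (1 : G)) 1
      (show E from X) = X :=
    (tangentBundleCore 𝓘(ℝ, E) G).coordChange_self _ _ (mem_chart_source E (1 : G)) _
  change _ = (tangentBundleCore 𝓘(ℝ, ℂ) ℂ).coordChange (achart ℂ (f.1 (g * 1)))
    (achart ℂ (f.1 (g₀ * 1))) (f.1 (g * 1))
      ((mfderiv 𝓘(ℝ, E) 𝓘(ℝ, ℂ) (fun x => f.1 (g * x)) 1)
        ((tangentBundleCore 𝓘(ℝ, E) G).coordChange (achart E (1 : G)) (achart E (1 : G)) 1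
          (show E from X)))
  rw [h6]
  simp only [tangentBundleCore_coordChange_model_space]
  rfl

/-- The left invariant vector field `X̃`, as an operator on `C^∞(G)`: `(X̃ f)(g)` is the
derivative of `x ↦ f(g x)` at the identity in the direction `X`. -/
def leftInvReal : LieAlg E G →ₗ[ℝ] Op E G where
  toFun X :=
    { toFun f := ⟨fun g => (mfderiv 𝓘(ℝ, E) 𝓘(ℝ, ℂ) (fun x => f.1 (g * x)) 1 X : ℂ),
        contMDiff_leftInv X f⟩
      map_add' f f' := SmoothFun.ext' fun g => congrArg (fun L : E →L[ℝ] ℂ => L X)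
        ((f.hasMFDerivAt_mul g).add (f'.hasMFDerivAt_mul g)).mfderiv
      map_smul' c f := SmoothFun.ext' fun g => by
        have h1 : HasMFDerivAt 𝓘(ℝ, ℂ) 𝓘(ℝ, ℂ) (fun z : ℂ => c * z) (f.1 (g * 1))
            (ContinuousLinearMap.mul ℝ ℂ c) :=
          (ContinuousLinearMap.mul ℝ ℂ c).hasFDerivAt.hasMFDerivAt
        have h2 := HasMFDerivAt.comp (1 : G) h1 (f.hasMFDerivAt_mul g)
        exact congrArg (fun L : E →L[ℝ] ℂ => L X) h2.mfderiv }
  map_add' X Y := LinearMap.ext fun f => SmoothFun.ext' fun g =>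
    map_add (mfderiv 𝓘(ℝ, E) 𝓘(ℝ, ℂ) (fun x => f.1 (g * x)) 1) X Y
  map_smul' c X := LinearMap.ext fun f => SmoothFun.ext' fun g =>
    (map_smul (mfderiv 𝓘(ℝ, E) 𝓘(ℝ, ℂ) (fun x => f.1 (g * x)) 1) c X).trans
      (Complex.real_smul)

/-- The complex linear extension `X ↦ X̃` to `𝔤^ℂ`. -/
def leftInv : ℂ ⊗[ℝ] LieAlg E G →ₗ[ℂ] Op E G := leftInvReal.liftBaseChange ℂ

variable (E G) in
/-- The symmetrization map `λ : S(𝔤) → 𝔻(G)`,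
`λ(Y₁ ⋯ Y_m) = (1/m!) ∑_σ Ỹ_{σ(1)} ⋯ Ỹ_{σ(m)}` (see `symmetrization_prod`). -/
def lam : SymC (LieAlg E G) →ₗ[ℂ] Op E G := symmetrization leftInv

/-- `γ` is the curve `t ↦ exp(tX)`: the integral curve of the left invariant vector field of `X`
with `γ(0) = 1`. -/
def IsExpCurve (X : LieAlg E G) (γ : ℝ → G) : Prop :=
  γ 0 = 1 ∧ IsMIntegralCurve (I := 𝓘(ℝ, E)) γ (mulInvariantVectorField X)

/-- `(X̃ f)(g exp(tX)) = d/dt f(g exp(tX))`. -/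
theorem IsExpCurve.hasDerivAt {X : LieAlg E G} {γ : ℝ → G} (h : IsExpCurve X γ)
    (f : SmoothFun E G) (g : G) (t : ℝ) :
    HasDerivAt (fun t => f.1 (g * γ t)) ((leftInvReal X f).1 (g * γ t)) t := by
  have hf : MDifferentiableAt 𝓘(ℝ, E) 𝓘(ℝ, ℂ) (fun x => f.1 (g * x)) (γ t) :=
    ((leftTranslate g f).2.mdifferentiable (by simp)) _
  let A : E →L[ℝ] ℂ := mfderiv 𝓘(ℝ, E) 𝓘(ℝ, ℂ) (fun x => f.1 (g * x)) (γ t)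
  let v : E := mulInvariantVectorField X (γ t)
  have h1 : HasFDerivAt (fun t => f.1 (g * γ t)) (A ∘L (1 : ℝ →L[ℝ] ℝ).smulRight v) t :=
    (HasMFDerivAt.comp t hf.hasMFDerivAt (h.2 t)).hasFDerivAt
  have hm : MDifferentiableAt 𝓘(ℝ, E) 𝓘(ℝ, E) (fun x : G => γ t * x) 1 :=
    ((contMDiff_mul_left (I := 𝓘(ℝ, E)) (n := ∞) (a := γ t)).mdifferentiable (by simp)) _
  have aux : ∀ (y : G) (L : E →L[ℝ] ℂ), y = γ t →
      HasMFDerivAt 𝓘(ℝ, E) 𝓘(ℝ, ℂ) (fun z => f.1 (g * z)) (γ t) L →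
      HasMFDerivAt 𝓘(ℝ, E) 𝓘(ℝ, ℂ) (fun z => f.1 (g * z)) y L := by
    intro y L hy h
    subst hy
    exact h
  have h2 := HasMFDerivAt.comp (1 : G) (aux _ _ (mul_one _) hf.hasMFDerivAt) hm.hasMFDerivAt
  have h3 : (fun z => f.1 (g * z)) ∘ (fun x : G => γ t * x) = fun x => f.1 (g * γ t * x) := by
    funext x
    simp only [Function.comp_apply, mul_assoc]
  rw [h3] at h2
  have h4 := congrArg (fun L : E →L[ℝ] ℂ => L X) h2.mfderiv
  have h5 := h1.hasDerivAt
  refine h5.congr_deriv ?_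
  refine Eq.trans ?_ h4.symm
  change A ((1 : ℝ) • v) = _
  rw [one_smul]
  rfl

/-- `(λ(X^m) f)(g)` is the `m`-th derivative of `t ↦ f(g exp(tX))` at `t = 0`. As the powers
`X^m` span `S(𝔤)`, this says that `λ(P)` is obtained by applying `P(∂/∂t₁, …, ∂/∂tₙ)` to
`f(g exp(t₁X₁ + ⋯ + tₙXₙ))` at `t = 0`, for any basis `X₁, …, Xₙ` of `𝔤`. -/
theorem lam_pow_apply {X : LieAlg E G} {γ : ℝ → G} (h : IsExpCurve X γ) (f : SmoothFun E G)
    (g : G) (m : ℕ) :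
    (lam E G (SymmetricAlgebra.ι ℂ (ℂ ⊗[ℝ] LieAlg E G) (1 ⊗ₜ X) ^ m) f).1 g =
      iteratedDeriv m (fun t => f.1 (g * γ t)) 0 := by
  have h1 : lam E G (SymmetricAlgebra.ι ℂ (ℂ ⊗[ℝ] LieAlg E G) (1 ⊗ₜ X) ^ m) =
      leftInvReal X ^ m := by
    have h2 := symmetrization_prod (leftInv (E := E) (G := G)) (m := m) fun _ => 1 ⊗ₜ X
    rw [Finset.prod_const, Finset.card_univ, Fintype.card_fin] at h2
    have h3 : ((m ! : ℕ) : ℂ) ≠ 0 := Nat.cast_ne_zero.mpr (Nat.factorial_ne_zero m)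
    rw [lam, h2, symProd]
    simp only [leftInv, LinearMap.liftBaseChange_tmul, one_smul, List.ofFn_const,
      List.prod_replicate, Finset.sum_const, Finset.card_univ, Fintype.card_perm,
      Fintype.card_fin]
    rw [← Nat.cast_smul_eq_nsmul ℂ, smul_smul, inv_mul_cancel₀ h3, one_smul]
  have h4 : ∀ (m : ℕ) (t : ℝ), iteratedDeriv m (fun t => f.1 (g * γ t)) t =
      ((leftInvReal X ^ m) f).1 (g * γ t) := by
    intro m
    induction m with
    | zero => intro t; simp
    | succ m ih =>
      intro t
      rw [iteratedDeriv_succ, funext ih, (h.hasDerivAt _ g t).deriv, pow_succ']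
      rfl
  rw [h1, h4, h.1, mul_one]

/-! ### The adjoint action -/

/-- The adjoint action `Ad(g)` on `𝔤`: the differential of `x ↦ g x g⁻¹` at the identity.
(The tangent spaces at `g 1 g⁻¹` and at `1` are the same.) -/
def Ad (g : G) : LieAlg E G →ₗ[ℝ] LieAlg E G :=
  (mfderiv 𝓘(ℝ, E) 𝓘(ℝ, E) (fun x : G => g * x * g⁻¹) (1 : G) : E →L[ℝ] E).toLinearMap

/-- The action of `Ad(g)` on operators, `(Ad(g)D) f = (D f^{R(g⁻¹)})^{R(g)}`. It is an algebra
automorphism which extends the adjoint action on `𝔤` (`adOp_leftInvReal`). -/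
def adOp (g : G) : Op E G ≃ₐ[ℂ] Op E G where
  toFun D := rightTranslate g * D * rightTranslate g⁻¹
  invFun D := rightTranslate g⁻¹ * D * rightTranslate g
  left_inv D := by
    have h := rightTranslate_mul_inv (E := E) g⁻¹
    rw [inv_inv] at h
    simp only [mul_assoc, h, mul_one]
    rw [← mul_assoc, h, one_mul]
  right_inv D := by
    have h := rightTranslate_mul_inv (E := E) g
    simp only [mul_assoc, h, mul_one]
    rw [← mul_assoc, h, one_mul]
  map_mul' D D' := by
    have h := rightTranslate_mul_inv (E := E) g⁻¹
    rw [inv_inv] at h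
    simp only [mul_assoc]
    rw [← mul_assoc (rightTranslate g⁻¹) (rightTranslate g), h, one_mul]
  map_add' D D' := by rw [mul_add, add_mul]
  commutes' c := by
    rw [Algebra.algebraMap_eq_smul_one, mul_smul_comm, mul_one, smul_mul_assoc,
      rightTranslate_mul_inv]

theorem adOp_leftInvReal (g : G) (X : LieAlg E G) :
    adOp g (leftInvReal X) = leftInvReal (Ad g X) := by
  refine LinearMap.ext fun f => SmoothFun.ext' fun x => ?_
  have hc : ContMDiff 𝓘(ℝ, E) 𝓘(ℝ, E) ∞ (fun y : G => g * y * g⁻¹) :=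
    (contMDiff_mul_right (I := 𝓘(ℝ, E)) (a := g⁻¹)).comp
      (contMDiff_mul_left (I := 𝓘(ℝ, E)) (a := g))
  have h1 := ((hc.mdifferentiable (by simp)) 1).hasMFDerivAt
  have h2 := f.hasMFDerivAt_mul x
  have aux : ∀ (y : G) (L : E →L[ℝ] ℂ), y = 1 →
      HasMFDerivAt 𝓘(ℝ, E) 𝓘(ℝ, ℂ) (fun z => f.1 (x * z)) 1 L →
      HasMFDerivAt 𝓘(ℝ, E) 𝓘(ℝ, ℂ) (fun z => f.1 (x * z)) y L := by
    intro y L hy h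
    subst hy
    exact h
  have h3 := HasMFDerivAt.comp (1 : G) (aux _ _ (by simp) h2) h1
  have h4 : (fun z => f.1 (x * z)) ∘ (fun y : G => g * y * g⁻¹) =
      fun y => (rightTranslate g⁻¹ f).1 (x * g * y) := by
    funext y
    change f.1 (x * (g * y * g⁻¹)) = f.1 (x * g * y * g⁻¹)
    simp only [mul_assoc]
  rw [h4] at h3
  exact congrArg (fun L : E →L[ℝ] ℂ => L X) h3.mfderiv

/-! ### The data attached to a closed subgroup `H` and a character `χ` -/

/-- The Lie algebra `𝔥` of a closed subgroup `H`: all `X` with `exp(tX) ∈ H` for all real `t`.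
(For closed `H` these `X` form a linear subspace, which is therefore equal to its span.) -/
def lieSubalg (H : Subgroup G) : Submodule ℝ (LieAlg E G) :=
  Submodule.span ℝ {X | ∃ γ : ℝ → H, IsExpCurve X fun t => (γ t : G)}

/-- `C^∞_{H,χ}(G)`, the smooth functions with `f(gh) = f(g) χ(h⁻¹)`. -/
def EquivFun (H : Subgroup G) (χ : H →* ℂˣ) : Submodule ℂ (SmoothFun E G) where
  carrier := {f | ∀ (g : G) (h : H), f.1 (g * h) = f.1 g * (χ h⁻¹ : ℂˣ)}
  add_mem' {f f'} hf hf' g h := by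
    have : (f + f').1 = f.1 + f'.1 := rfl
    simp only [this, Pi.add_apply, hf g h, hf' g h, add_mul]
  zero_mem' g h := by
    have : (0 : SmoothFun E G).1 = 0 := rfl
    simp [this]
  smul_mem' c f hf g h := by
    have : (c • f).1 = c • f.1 := rfl
    simp only [this, Pi.smul_apply, hf g h, smul_eq_mul, mul_assoc]

/-- `𝔥^χ = {X + χ(X) : X ∈ 𝔥^ℂ}`, the complex span of the `X̃ + dχ(X)` with `X ∈ 𝔥`; here
`dχ(X)` is the derivative of `t ↦ χ(exp(tX))` at `0`. -/
def hChi (H : Subgroup G) (χ : H →* ℂˣ) : Submodule ℂ (Op E G) :=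
  Submodule.span ℂ {D | ∃ (X : LieAlg E G) (γ : ℝ → H) (c : ℂ),
    IsExpCurve X (fun t => (γ t : G)) ∧ HasDerivAt (fun t => ((χ (γ t) : ℂˣ) : ℂ)) c 0 ∧
      D = leftInvReal X + c • 1}

/-- `𝔻(G)𝔥^χ`, the linear span of the products `vw` with `v ∈ 𝔻(G)` and `w ∈ 𝔥^χ`. -/
def leftIdealChi (H : Subgroup G) (χ : H →* ℂˣ) : Submodule ℂ (Op E G) :=
  Submodule.span ℂ {D | ∃ v ∈ InvDiffOp E G, ∃ w ∈ hChi H χ, D = v * w}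

/-- `𝔻_{H,χ,mod}(G)`: the `D ∈ 𝔻(G)` with `Ad(h)D - D ∈ 𝔻(G)𝔥^χ` for all `h ∈ H`. -/
def DMod (H : Subgroup G) (χ : H →* ℂˣ) : Submodule ℂ (Op E G) where
  carrier := {D | D ∈ InvDiffOp E G ∧ ∀ h ∈ H, adOp h D - D ∈ leftIdealChi H χ}
  add_mem' {D D'} hD hD' := ⟨add_mem hD.1 hD'.1, fun h hh => by
    have := add_mem (hD.2 h hh) (hD'.2 h hh)
    rwa [sub_add_sub_comm, ← map_add] at this⟩
  zero_mem' := ⟨zero_mem _, fun h _ => by simp⟩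
  smul_mem' c D hD := ⟨Submodule.smul_mem _ c hD.1, fun h hh => by
    have := Submodule.smul_mem _ c (hD.2 h hh)
    rwa [smul_sub, ← map_smul] at this⟩

/-- `I_mod(𝔪) = {P ∈ S(𝔪) : σ ∘ Ad(h) P = P for all h ∈ H}`, where `σ : 𝔤 → 𝔪` is the projection
along `𝔥`, and `σ` and `Ad(h)` are extended to algebra homomorphisms of `S(𝔤)`. -/
def IMod (H : Subgroup G) (M : Submodule ℝ (LieAlg E G)) (hM : IsCompl M (lieSubalg H)) :
    Subalgebra ℂ (SymC (LieAlg E G)) where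
  carrier := {P | P ∈ SymC.sub M ∧
    ∀ h ∈ H, SymC.map (M.projection (lieSubalg H) hM) (SymC.map (Ad h) P) = P}
  mul_mem' hP hQ := ⟨mul_mem hP.1 hQ.1, fun h hh => by
    rw [map_mul, map_mul, hP.2 h hh, hQ.2 h hh]⟩
  add_mem' hP hQ := ⟨add_mem hP.1 hQ.1, fun h hh => by
    rw [map_add, map_add, hP.2 h hh, hQ.2 h hh]⟩
  algebraMap_mem' c := ⟨Subalgebra.algebraMap_mem _ c, fun h _ => by
    rw [AlgHom.commutes, AlgHom.commutes]⟩

/-- The restriction `D ↦ D|_{C^∞_{H,χ}(G)}`. -/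
def restrictOp (H : Subgroup G) (χ : H →* ℂˣ) :
    Op E G →ₗ[ℂ] (EquivFun (E := E) H χ →ₗ[ℂ] SmoothFun E G) where
  toFun D := D ∘ₗ (EquivFun H χ).subtype
  map_add' _ _ := rfl
  map_smul' _ _ := rfl

end LieGroupDefs

end

/-!
Two facts carry the proof.

* Reduction (`wordSpan_le_sup`, `lam_sub_lam_map_projection_mem`). `𝔻(G)` is spanned by products of
  left invariant vector fields (`exists_mem_wordSpan`). Modulo products of fewer factors the factors
  commute, and a factor from `𝔥`, moved to the right, becomes a scalar modulo `𝔻(G)𝔥^χ`. So every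
  operator is congruent modulo `𝔻(G)𝔥^χ` to some `λ(P)` with `P ∈ S(𝔪)`, and for `P` homogeneous
  `λ(P)` is congruent to `λ(σ P)` up to terms of lower order.
* Faithfulness (`eq_zero_of_lam_annihilates`). If `P ∈ S(𝔪)` is nonzero then `λ(P)` does not
  annihilate `C^∞_{H,χ}(G)`. Applied to `x₁ ⋯ x_d f`, where `d` is the degree of `P`, the `xⱼ` are
  right `H`-invariant functions vanishing at `1` and `f ∈ C^∞_{H,χ}(G)`, the operator sees at `1`
  only the leading term of `P`, paired with the differentials of the `xⱼ`
  (`factorial_smul_eq_sum`). It remains to know that `f(1) ≠ 0` can be achieved and that these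
  differentials span the dual of `𝔪` (`exists_dual_equivFun`).

The functions are obtained by integrating compactly supported functions over `H` against `χ`
(`exists_equivFun_integral`); this makes the manifold structure of `H` superfluous. If `X` is
killed by all differentials at `1` of right `H`-invariant functions, then these functions are
constant along `exp(tX)`, and as they separate `H` from its complement, `exp(tX)` stays in `H`, so
`X ∈ 𝔥` (`mem_lieSubalg_of_forall`).

As `𝔻(G)𝔥^χ` annihilates `C^∞_{H,χ}(G)`, the two facts show that it is exactly the annihilator
in `𝔻(G)`, so it is stable under `Ad(H)`, and that `𝔻(G) = λ(S(𝔪)) ⊕ 𝔻(G)𝔥^χ`. If `P ∈ S(𝔪)` and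
`λ(P) ∈ 𝔻_{H,χ,mod}(G)`, then comparing leading terms in `Ad(h)λ(P) - λ(P)` shows that the leading
term of `P` lies in `I_mod(𝔪)` (`homog_mem_IMod`). By hypothesis it can be subtracted, and induction
on the degree gives `P ∈ I_mod(𝔪)`.
-/

set_option linter.unusedSectionVars false

/-! ### Left invariant vector fields in charts -/

section Charts

variable {E : Type*} [NormedAddCommGroup E] [NormedSpace ℝ E] [FiniteDimensional ℝ E]
  {G : Type*} [TopologicalSpace G] [ChartedSpace E G] [Group G] [LieGroup 𝓘(ℝ, E) ∞ G]

/-- In the chart `e` at `x₀`, the left invariant vector field of `X` is `v ↦ chartField x₀ v X`: the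
derivative of `x ↦ e (e⁻¹(v) x)` at the identity, taken in the direction `X`. It is the actual
field for `v` in the target of the chart only. -/
noncomputable def chartField (x₀ : G) (v : E) : E →L[ℝ] E :=
  mfderiv 𝓘(ℝ, E) 𝓘(ℝ, E) (fun x : G => chartAt E x₀ ((chartAt E x₀).symm v * x)) 1

theorem contMDiffAt_chart_mul (x₀ : G) {v : E} (hv : v ∈ (chartAt E x₀).target) :
    ContMDiffAt (𝓘(ℝ, E).prod 𝓘(ℝ, E)) 𝓘(ℝ, E) ∞
      (Function.uncurry fun (w : E) (x : G) => chartAt E x₀ ((chartAt E x₀).symm w * x))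
      (v, 1) := by
  have h1 : ContMDiffAt 𝓘(ℝ, E) 𝓘(ℝ, E) ∞ (chartAt E x₀).symm v :=
    (contMDiffOn_chart_symm (I := 𝓘(ℝ, E)) (n := ∞) (x := x₀)).contMDiffAt
      ((chartAt E x₀).open_target.mem_nhds hv)
  have h2 : ContMDiffAt 𝓘(ℝ, E) 𝓘(ℝ, E) ∞ (chartAt E x₀) ((chartAt E x₀).symm v * 1) :=
    (contMDiffOn_chart (I := 𝓘(ℝ, E)) (n := ∞) (x := x₀)).contMDiffAt
      ((chartAt E x₀).open_source.mem_nhds (by simpa using (chartAt E x₀).map_target hv))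
  have h3 : ContMDiffAt (𝓘(ℝ, E).prod 𝓘(ℝ, E)) 𝓘(ℝ, E) ∞
      (fun p : E × G => (chartAt E x₀).symm p.1 * p.2) (v, 1) :=
    (h1.comp (v, (1 : G)) contMDiffAt_fst).mul contMDiffAt_snd
  exact ContMDiffAt.comp (v, (1 : G)) h2 h3

theorem contDiffOn_chartField (x₀ : G) :
    ContDiffOn ℝ ∞ (chartField (E := E) x₀) (chartAt E x₀).target := by
  intro v₀ hv₀
  have h2 := ContMDiffAt.mfderiv (x₀ := v₀) (m := ∞)
    (fun (w : E) (x : G) => chartAt E x₀ ((chartAt E x₀).symm w * x)) (fun _ : E => (1 : G))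
    (contMDiffAt_chart_mul x₀ hv₀) contMDiffAt_const (by simp)
  refine (ContMDiffAt.contDiffAt (h2.congr_of_eventuallyEq
    (Filter.Eventually.of_forall fun v => ?_))).contDiffWithinAt
  have h4 := inTangentCoordinates_eq (I := 𝓘(ℝ, E)) (I' := 𝓘(ℝ, E)) (fun _ : E => (1 : G))
    (fun w : E => chartAt E x₀ ((chartAt E x₀).symm w * 1))
    (fun w : E => chartField x₀ w) (x₀ := v₀) (x := v)
    (mem_chart_source E (1 : G))
    (by rw [chartAt_self_eq]; exact Set.mem_univ _)
  refine Eq.trans ?_ h4.symm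
  ext X
  have h6 : (tangentBundleCore 𝓘(ℝ, E) G).coordChange (achart E (1 : G)) (achart E (1 : G)) 1 X =
      X :=
    (tangentBundleCore 𝓘(ℝ, E) G).coordChange_self _ _ (mem_chart_source E (1 : G)) _
  change _ = (tangentBundleCore 𝓘(ℝ, E) E).coordChange _ _ _ (chartField x₀ v
    ((tangentBundleCore 𝓘(ℝ, E) G).coordChange (achart E (1 : G)) (achart E (1 : G)) 1 X))
  rw [h6]
  simp only [tangentBundleCore_coordChange_model_space]
  rfl

theorem SmoothFun.contDiffOn_chart (f : SmoothFun E G) (x₀ : G) :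
    ContDiffOn ℝ ∞ (fun v => f.1 ((chartAt E x₀).symm v)) (chartAt E x₀).target :=
  ((f.2.contMDiffOn (s := Set.univ)).comp (contMDiffOn_chart_symm (I := 𝓘(ℝ, E)) (n := ∞) (x := x₀))
    (fun _ _ => Set.mem_univ _)).contDiffOn

/-- `chartField` is the vector field by which `X̃` acts in the chart. -/
theorem leftInvReal_chart (x₀ : G) (X : LieAlg E G) (f : SmoothFun E G) {v : E}
    (hv : v ∈ (chartAt E x₀).target) :
    (leftInvReal X f).1 ((chartAt E x₀).symm v) =
      fderiv ℝ (fun v => f.1 ((chartAt E x₀).symm v)) v (chartField x₀ v X) := by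
  have hs := (chartAt E x₀).map_target hv
  have aux : (chartAt E x₀) ((chartAt E x₀).symm v * 1) = v := by
    rw [mul_one, (chartAt E x₀).right_inv hv]
  have h1 : HasMFDerivAt 𝓘(ℝ, E) 𝓘(ℝ, ℂ) (fun v => f.1 ((chartAt E x₀).symm v))
      ((chartAt E x₀) ((chartAt E x₀).symm v * 1))
      (fderiv ℝ (fun v => f.1 ((chartAt E x₀).symm v)) v) := by
    rw [aux]
    exact (((f.contDiffOn_chart x₀).contDiffAt
      ((chartAt E x₀).open_target.mem_nhds hv)).differentiableAt (by simp)).hasFDerivAt.hasMFDerivAt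
  have h2 : MDifferentiableAt 𝓘(ℝ, E) 𝓘(ℝ, E)
      (fun x : G => chartAt E x₀ ((chartAt E x₀).symm v * x)) 1 :=
    (((contMDiffAt_chart_mul x₀ hv).comp (1 : G)
      (contMDiffAt_const.prodMk contMDiffAt_id)).mdifferentiableAt (by simp))
  have h3 := HasMFDerivAt.comp (1 : G) h1 h2.hasMFDerivAt
  have h4 : (fun x : G => f.1 ((chartAt E x₀).symm v * x)) =ᶠ[𝓝 1]
      (fun v => f.1 ((chartAt E x₀).symm v)) ∘
        (fun x : G => chartAt E x₀ ((chartAt E x₀).symm v * x)) := by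
    have hc : Filter.Tendsto (fun x : G => (chartAt E x₀).symm v * x) (𝓝 1)
        (𝓝 ((chartAt E x₀).symm v * 1)) :=
      ((contMDiff_mul_left (I := 𝓘(ℝ, E)) (n := ∞)
        (a := (chartAt E x₀).symm v)).continuous).tendsto _
    rw [mul_one] at hc
    filter_upwards [hc ((chartAt E x₀).open_source.mem_nhds hs)] with x hx
    simp only [Function.comp_apply]
    rw [(chartAt E x₀).left_inv hx]
  have h5 := (h3.congr_of_eventuallyEq h4).mfderiv
  exact congrArg (fun L : E →L[ℝ] ℂ => L X) h5

/-- In its own chart, a tangent vector at the identity is represented by itself. -/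
theorem chartField_one : chartField (1 : G) (chartAt E (1 : G) 1) = ContinuousLinearMap.id ℝ E := by
  have h : (fun x : G => chartAt E (1 : G) ((chartAt E (1 : G)).symm (chartAt E (1 : G) 1) * x)) =
      extChartAt 𝓘(ℝ, E) (1 : G) := by
    funext x
    rw [(chartAt E (1 : G)).left_inv (mem_chart_source E (1 : G)), one_mul]
    simp
  rw [chartField, h]
  have h2 := mfderiv_chartAt_eq_tangentCoordChange (I := 𝓘(ℝ, E)) (x := (1 : G))
    (y := (1 : G)) (mem_chart_source E (1 : G))
  refine h2.trans ?_
  ext v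
  exact tangentCoordChange_self (I := 𝓘(ℝ, E)) (mem_extChartAt_source (1 : G))

theorem leftTranslate_mul_leftInvReal (g : G) (X : LieAlg E G) :
    leftInvReal X * leftTranslate g = leftTranslate g * leftInvReal X := by
  refine LinearMap.ext fun f => SmoothFun.ext' fun x => ?_
  change (mfderiv 𝓘(ℝ, E) 𝓘(ℝ, ℂ) (fun y => f.1 (g * (x * y))) 1 X : ℂ) =
    (mfderiv 𝓘(ℝ, E) 𝓘(ℝ, ℂ) (fun y => f.1 (g * x * y)) 1 X : ℂ)
  have h : (fun y => f.1 (g * (x * y))) = fun y => f.1 (g * x * y) :=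
    funext fun y => congrArg f.1 (mul_assoc g x y).symm
  rw [h]
  rfl

theorem op_ext_of_leftInvariant {D D' : Op E G}
    (hD : ∀ g : G, D * leftTranslate g = leftTranslate g * D)
    (hD' : ∀ g : G, D' * leftTranslate g = leftTranslate g * D')
    (h : ∀ f : SmoothFun E G, (D f).1 1 = (D' f).1 1) : D = D' := by
  refine LinearMap.ext fun f => SmoothFun.ext' fun x => ?_
  have h1 := congrArg (fun T : Op E G => (T f).1 1) (hD x)
  have h2 := congrArg (fun T : Op E G => (T f).1 1) (hD' x)
  have h3 := h (leftTranslate x f)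
  have e1 : (D f).1 (x * 1) = (D f).1 x := by rw [mul_one]
  have e2 : (D' f).1 (x * 1) = (D' f).1 x := by rw [mul_one]
  exact e1.symm.trans (h1.symm.trans (h3.trans (h2.trans e2)))

/-- The left invariant vector fields are closed under commutators. In the chart at the identity the
second derivatives of the function cancel by symmetry, and what remains is a first derivative
at `1` along a vector `Z`; left invariance does the rest. -/
theorem exists_leftInvReal_commutator (X Y : LieAlg E G) : ∃ Z : LieAlg E G,
    leftInvReal X * leftInvReal Y - leftInvReal Y * leftInvReal X = leftInvReal Z := by
  set e := chartAt E (1 : G) with he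
  set v₀ := e 1 with hv₀
  have hv : v₀ ∈ e.target := e.map_source (mem_chart_source E (1 : G))
  have hB : DifferentiableAt ℝ (chartField (E := E) (1 : G)) v₀ :=
    ((contDiffOn_chartField (1 : G)).contDiffAt (e.open_target.mem_nhds hv)).differentiableAt
      (by simp)
  let Z : E := fderiv ℝ (chartField (E := E) (1 : G)) v₀ X Y -
    fderiv ℝ (chartField (E := E) (1 : G)) v₀ Y X
  refine ⟨Z, op_ext_of_leftInvariant ?_ (fun g => leftTranslate_mul_leftInvReal g _) ?_⟩
  · intro g
    have h := fun W : LieAlg E G => leftTranslate_mul_leftInvReal g W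
    rw [sub_mul, mul_sub, mul_assoc, mul_assoc, h X, h Y, ← mul_assoc, ← mul_assoc, h X, h Y,
      mul_assoc, mul_assoc]
  intro f
  set F : E → ℂ := fun v => f.1 (e.symm v) with hF
  have hFc : ContDiffAt ℝ ∞ F v₀ := (f.contDiffOn_chart 1).contDiffAt (e.open_target.mem_nhds hv)
  have hF2 : DifferentiableAt ℝ (fderiv ℝ F) v₀ :=
    (hFc.fderiv_right (m := ∞) (by simp)).differentiableAt (by simp)
  have h1 : e.symm v₀ = 1 := e.left_inv (mem_chart_source E (1 : G))
  have key : ∀ U V : LieAlg E G, ((leftInvReal U * leftInvReal V) f).1 1 =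
      fderiv ℝ (fderiv ℝ F) v₀ U V +
        fderiv ℝ F v₀ (fderiv ℝ (chartField (E := E) (1 : G)) v₀ U V) := by
    intro U V
    have h2 := leftInvReal_chart (1 : G) U (leftInvReal V f) hv
    have h3 : (fun v => (leftInvReal V f).1 (e.symm v)) =ᶠ[𝓝 v₀]
        fun v => fderiv ℝ F v (chartField (1 : G) v V) := by
      filter_upwards [e.open_target.mem_nhds hv] with v hv'
      exact leftInvReal_chart (1 : G) V f hv'
    rw [← he, h3.fderiv_eq, h1, chartField_one] at h2
    refine h2.trans ?_
    have h4 := (hF2.hasFDerivAt.clm_apply (hB.hasFDerivAt.clm_apply (hasFDerivAt_const (V : E) v₀)))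
    rw [h4.fderiv]
    change fderiv ℝ F v₀ (chartField (1 : G) v₀ (0 : E) +
        fderiv ℝ (chartField (E := E) (1 : G)) v₀ U V) +
      fderiv ℝ (fderiv ℝ F) v₀ U (chartField (1 : G) v₀ V) = _
    have h5 : chartField (1 : G) v₀ = ContinuousLinearMap.id ℝ E := chartField_one
    rw [h5, map_zero, zero_add, add_comm]
    rfl
  have hsymm : fderiv ℝ (fderiv ℝ F) v₀ X Y = fderiv ℝ (fderiv ℝ F) v₀ Y X :=
    (hFc.isSymmSndFDerivAt (by simpa using WithTop.coe_le_coe.2 (le_top : (2 : ℕ∞) ≤ ⊤))).eq X Y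
  have hZ := leftInvReal_chart (1 : G) Z f hv
  rw [← he, h1, chartField_one] at hZ
  rw [hZ]
  have h5 : ((leftInvReal X * leftInvReal Y - leftInvReal Y * leftInvReal X) f).1 1 =
    ((leftInvReal X * leftInvReal Y) f).1 1 - ((leftInvReal Y * leftInvReal X) f).1 1 := rfl
  rw [h5, key, key, hsymm, add_sub_add_left_eq_sub, ← map_sub]
  rfl

end Charts

/-! ### Words in left invariant vector fields and local spans -/

section Words

variable {E : Type*} [NormedAddCommGroup E] [NormedSpace ℝ E] [FiniteDimensional ℝ E]
  {G : Type*} [TopologicalSpace G] [ChartedSpace E G] [Group G] [LieGroup 𝓘(ℝ, E) ∞ G]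

/-- The product `X̃₁ ⋯ X̃ₖ` of the left invariant vector fields of a list of vectors. -/
noncomputable def word (L : List (LieAlg E G)) : Op E G := (L.map leftInvReal).prod

@[simp] theorem word_nil : (word [] : Op E G) = 1 := rfl

@[simp] theorem word_cons (X : LieAlg E G) (L : List (LieAlg E G)) :
    word (X :: L) = leftInvReal X * word L := by simp [word]

@[simp] theorem word_append (L L' : List (LieAlg E G)) :
    word (L ++ L') = word L * word L' := by simp [word]

variable (E G) in
/-- The span of the words of length less than `N`, i.e. of the left invariant operators of order
less than `N`. -/
noncomputable def wordSpan (N : ℕ) : Submodule ℂ (Op E G) :=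
  Submodule.span ℂ {D | ∃ L : List (LieAlg E G), L.length < N ∧ D = word L}

theorem word_mem_wordSpan {N : ℕ} (L : List (LieAlg E G)) (h : L.length < N) :
    word L ∈ wordSpan E G N :=
  Submodule.subset_span ⟨L, h, rfl⟩

theorem wordSpan_mono {M N : ℕ} (h : M ≤ N) : wordSpan E G M ≤ wordSpan E G N :=
  Submodule.span_mono fun _ ⟨L, hL, hD⟩ => ⟨L, hL.trans_le h, hD⟩

theorem word_mul_leftTranslate (L : List (LieAlg E G)) (g : G) :
    word L * leftTranslate g = leftTranslate g * word L := by
  induction L with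
  | nil => simp
  | cons X L ih => rw [word_cons, mul_assoc, ih, ← mul_assoc, leftTranslate_mul_leftInvReal,
      mul_assoc]

theorem wordSpan_mul_leftTranslate {N : ℕ} {D : Op E G} (hD : D ∈ wordSpan E G N) (g : G) :
    D * leftTranslate g = leftTranslate g * D := by
  induction hD using Submodule.span_induction with
  | mem D h => obtain ⟨L, -, rfl⟩ := h; exact word_mul_leftTranslate L g
  | zero => simp
  | add D D' _ _ h h' => rw [add_mul, mul_add, h, h']
  | smul c D _ h => rw [smul_mul_assoc, h, mul_smul_comm]

/-- `T` belongs to the span of `S` over the smooth functions on `Ω`, where `S` is a set of maps that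
send a smooth function on `G` to a function on `E`. Only the values on `Ω` count. -/
inductive LocalSpan (Ω : Set E) (S : Set (SmoothFun E G → E → ℂ)) :
    (SmoothFun E G → E → ℂ) → Prop
  | zero : LocalSpan Ω S fun _ _ => 0
  | smul_add {a : E → ℂ} {D T : SmoothFun E G → E → ℂ} (ha : ContDiffOn ℝ ∞ a Ω) (hD : D ∈ S)
      (hT : LocalSpan Ω S T) : LocalSpan Ω S fun f v => a v * D f v + T f v
  | congr {T T' : SmoothFun E G → E → ℂ} (hT : LocalSpan Ω S T)
      (h : ∀ f, ∀ v ∈ Ω, T f v = T' f v) : LocalSpan Ω S T'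

namespace LocalSpan

variable {Ω : Set E} {S : Set (SmoothFun E G → E → ℂ)} {T T' : SmoothFun E G → E → ℂ}

theorem add (h : LocalSpan Ω S T) (h' : LocalSpan Ω S T') :
    LocalSpan Ω S fun f v => T f v + T' f v := by
  induction h with
  | zero => exact h'.congr fun f v _ => by simp
  | smul_add ha hD _ ih => exact (ih.smul_add ha hD).congr fun f v _ => by ring
  | congr _ h ih => exact ih.congr fun f v hv => by rw [h f v hv]

theorem smul {b : E → ℂ} (hb : ContDiffOn ℝ ∞ b Ω) (h : LocalSpan Ω S T) :
    LocalSpan Ω S fun f v => b v * T f v := by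
  induction h with
  | zero => exact zero.congr fun f v _ => by simp
  | smul_add ha hD _ ih => exact (ih.smul_add (hb.mul ha) hD).congr fun f v _ => by ring
  | congr _ h ih => exact ih.congr fun f v hv => by rw [h f v hv]

theorem sum {ι : Type*} (s : Finset ι) {T : ι → SmoothFun E G → E → ℂ}
    (h : ∀ i ∈ s, LocalSpan Ω S (T i)) : LocalSpan Ω S fun f v => ∑ i ∈ s, T i f v := by
  classical
  induction s using Finset.induction_on with
  | empty => exact zero.congr fun f v _ => by simp
  | insert i s hi ih =>
    refine ((h i (Finset.mem_insert_self _ _)).add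
      (ih fun j hj => h j (Finset.mem_insert_of_mem hj))).congr fun f v _ => ?_
    rw [Finset.sum_insert hi]

theorem of_mem (h : T ∈ S) : LocalSpan Ω S T :=
  (zero.smul_add (contDiffOn_const (c := 1)) h).congr fun f v _ => by simp

theorem contDiffOn (hS : ∀ D ∈ S, ∀ f, ContDiffOn ℝ ∞ (D f) Ω) (h : LocalSpan Ω S T)
    (f : SmoothFun E G) : ContDiffOn ℝ ∞ (T f) Ω := by
  induction h with
  | zero => exact contDiffOn_const
  | smul_add ha hD _ ih => exact (ha.mul (hS _ hD f)).add ih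
  | congr _ h ih => exact ih.congr fun v hv => (h f v hv).symm

/-- If the span of `S` contains the derivatives of the members of `S` along a vector field `b`,
then it is stable under derivation along `b`. -/
theorem fderiv (hΩ : IsOpen Ω) (hS : ∀ D ∈ S, ∀ f, ContDiffOn ℝ ∞ (D f) Ω) {b : E → E}
    (hb : ContDiffOn ℝ ∞ b Ω)
    (hSb : ∀ D ∈ S, LocalSpan Ω S fun f v => _root_.fderiv ℝ (D f) v (b v))
    (h : LocalSpan Ω S T) : LocalSpan Ω S fun f v => _root_.fderiv ℝ (T f) v (b v) := by
  have hd : ∀ {a : E → ℂ}, ContDiffOn ℝ ∞ a Ω → ∀ v ∈ Ω, DifferentiableAt ℝ a v := fun h v hv =>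
    (h.contDiffAt (hΩ.mem_nhds hv)).differentiableAt (by simp)
  induction h with
  | zero => exact zero.congr fun f v _ => by simp
  | @smul_add a D T ha hD hT ih =>
    have h1 : ContDiffOn ℝ ∞ (fun v => _root_.fderiv ℝ a v (b v)) Ω :=
      (ha.fderiv_of_isOpen (m := ∞) hΩ (by simp)).clm_apply hb
    refine ((ih.add ((hSb D hD).smul ha)).add ((of_mem hD).smul h1)).congr fun f v hv => ?_
    have h2 := ((hd ha v hv).hasFDerivAt.mul (hd (hS D hD f) v hv).hasFDerivAt).add
      (hd (hT.contDiffOn hS f) v hv).hasFDerivAt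
    have h3 : _root_.fderiv ℝ (fun v => a v * D f v + T f v) v = _ := h2.fderiv
    rw [h3]
    simp only [_root_.add_apply, _root_.smul_apply, smul_eq_mul]
    ring
  | congr _ h ih =>
    refine ih.congr fun f v hv => ?_
    have : _ =ᶠ[𝓝 v] _ := Filter.eventuallyEq_of_mem (hΩ.mem_nhds hv) (h f)
    rw [this.fderiv_eq]

end LocalSpan

/-- The partial derivatives, of all orders, in the chart at `x₀`. -/
def chartPartials (x₀ : G) : Set (SmoothFun E G → E → ℂ) :=
  Set.range fun (p : Σ k : ℕ, Fin k → Fin (Module.finrank ℝ E)) f v =>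
    iteratedFDeriv ℝ p.1 (fun v : E => f.1 ((chartAt E x₀).symm v)) v
      (fun l => Module.finBasis ℝ E (p.2 l))

theorem contDiffOn_chartPartials (x₀ : G) :
    ∀ D ∈ chartPartials x₀, ∀ f : SmoothFun E G, ContDiffOn ℝ ∞ (D f) (chartAt E x₀).target := by
  rintro _ ⟨p, rfl⟩ f v hv
  have h1 := (f.contDiffOn_chart x₀).contDiffAt ((chartAt E x₀).open_target.mem_nhds hv)
  have h2 := h1.iteratedFDeriv_right (m := ∞) (i := p.1) (by
    exact_mod_cast le_of_eq (top_add _))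
  exact ((ContinuousMultilinearMap.apply ℝ (fun _ : Fin p.1 => E) ℂ
    (fun l => Module.finBasis ℝ E (p.2 l))).contDiff.contDiffAt.comp v h2).contDiffWithinAt

theorem fderiv_iteratedFDeriv_apply {F : E → ℂ} {v : E} (hF : ContDiffAt ℝ ∞ F v) (k : ℕ) (x : E)
    (m : Fin k → E) : fderiv ℝ (fun w => iteratedFDeriv ℝ k F w m) v x =
      iteratedFDeriv ℝ (k + 1) F v (Fin.cons x m) := by
  have h2 := hF.iteratedFDeriv_right (m := ∞) (i := k) (by
    exact_mod_cast le_of_eq (top_add _))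
  have h3 := (ContinuousMultilinearMap.apply ℝ (fun _ : Fin k => E) ℂ m).hasFDerivAt.comp v
    (h2.differentiableAt (by simp)).hasFDerivAt
  have h4 : fderiv ℝ (fun w => iteratedFDeriv ℝ k F w m) v = _ := h3.fderiv
  rw [h4, iteratedFDeriv_succ_apply_left]
  simp

theorem localSpan_fderiv_chartPartials (x₀ : G) (X : LieAlg E G) :
    ∀ D ∈ chartPartials x₀, LocalSpan (chartAt E x₀).target (chartPartials x₀)
      fun (f : SmoothFun E G) v => fderiv ℝ (D f) v (chartField x₀ v X) := by
  rintro _ ⟨p, rfl⟩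
  set B := Module.finBasis ℝ E
  have hX : ContDiffOn ℝ ∞ (fun v => chartField (E := E) x₀ v X) (chartAt E x₀).target :=
    (contDiffOn_chartField x₀).clm_apply contDiffOn_const
  refine (LocalSpan.sum Finset.univ (T := fun j f v =>
    ((B.repr (chartField x₀ v X) j : ℝ) : ℂ) *
      iteratedFDeriv ℝ (p.1 + 1) (fun v : E => f.1 ((chartAt E x₀).symm v)) v
        (fun l => B (Fin.cons (α := fun _ => Fin (Module.finrank ℝ E)) j p.2 l)))
    fun j _ => ?_).congr fun f v hv => ?_
  · refine LocalSpan.smul ?_ (LocalSpan.of_mem ⟨⟨p.1 + 1, Fin.cons j p.2⟩, rfl⟩)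
    have h1 : ContDiff ℝ ∞ fun w : E => ((B.repr w j : ℝ) : ℂ) :=
      (Complex.ofRealCLM ∘L LinearMap.toContinuousLinearMap (B.coord j)).contDiff
    exact h1.comp_contDiffOn hX
  · have h1 := (f.contDiffOn_chart x₀).contDiffAt ((chartAt E x₀).open_target.mem_nhds hv)
    conv_rhs => rw [← B.sum_repr (chartField x₀ v X)]
    rw [map_sum]
    refine Finset.sum_congr rfl fun j _ => ?_
    rw [map_smul, fderiv_iteratedFDeriv_apply h1, Complex.real_smul]
    congr 2
    funext l
    refine Fin.cases ?_ (fun l => ?_) l <;> simp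

/-- A word is a differential operator in every chart, by induction on its length: a left invariant
vector field is a smooth combination of the coordinate fields. -/
theorem localSpan_word (x₀ : G) (L : List (LieAlg E G)) :
    LocalSpan (chartAt E x₀).target (chartPartials x₀)
      fun (f : SmoothFun E G) v => (word L f).1 ((chartAt E x₀).symm v) := by
  induction L with
  | nil =>
    refine (LocalSpan.of_mem (S := chartPartials x₀) (Set.mem_range_self
      (⟨0, Fin.elim0⟩ : Σ k : ℕ, Fin k → Fin (Module.finrank ℝ E)))).congr fun f v hv => ?_
    exact iteratedFDeriv_zero_apply _
  | cons X L ih =>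
    refine (ih.fderiv (chartAt E x₀).open_target (contDiffOn_chartPartials x₀)
      ((contDiffOn_chartField x₀).clm_apply (contDiffOn_const (c := (show E from X))))
      (localSpan_fderiv_chartPartials x₀ X)).congr fun f v hv => ?_
    rw [word_cons]
    exact (leftInvReal_chart x₀ X (word L f) hv).symm

/-- Collected form of an element of the span of the partial derivatives. -/
theorem LocalSpan.exists_finset {Ω : Set E} {x₀ : G} {T : SmoothFun E G → E → ℂ}
    (h : LocalSpan Ω (chartPartials x₀) T) :
    ∃ (s : Finset (Σ k : ℕ, Fin k → Fin (Module.finrank ℝ E)))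
      (a : (Σ k : ℕ, Fin k → Fin (Module.finrank ℝ E)) → E → ℂ),
      (∀ p, ContDiffOn ℝ ∞ (a p) Ω) ∧ (∀ p ∉ s, a p = 0) ∧ ∀ f, ∀ v ∈ Ω, T f v = ∑ p ∈ s, a p v *
        iteratedFDeriv ℝ p.1 (fun v : E => f.1 ((chartAt E x₀).symm v)) v
          (fun l => Module.finBasis ℝ E (p.2 l)) := by
  classical
  induction h with
  | zero => exact ⟨∅, 0, fun _ => contDiffOn_const, fun _ _ => rfl, by simp⟩
  | @smul_add b D T hb hD _ ih =>
    obtain ⟨p, rfl⟩ := hD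
    obtain ⟨s, a, ha, has, hT⟩ := ih
    refine ⟨insert p s, fun q => (if q = p then b else 0) + a q, fun q => ?_, fun q hq => ?_,
      fun f v hv => ?_⟩
    · refine ContDiffOn.add ?_ (ha q)
      split_ifs
      · exact hb
      · exact contDiffOn_const
    · rw [Finset.mem_insert, not_or] at hq
      simp [hq.1, has q hq.2]
    · simp only [Pi.add_apply, add_mul, Finset.sum_add_distrib]
      rw [hT f v hv]
      congr 1
      · rw [Finset.sum_eq_single_of_mem p (Finset.mem_insert_self _ _)]
        · simp
        · intro q _ hq
          simp [hq]
      · refine Finset.sum_subset (Finset.subset_insert _ _) fun q _ hq => ?_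
        simp [has q hq]
  | congr _ h ih =>
    obtain ⟨s, a, ha, has, hT⟩ := ih
    exact ⟨s, a, ha, has, fun f v hv => (h f v hv).symm.trans (hT f v hv)⟩

theorem isDiffOp_word (L : List (LieAlg E G)) : IsDiffOp (word L) := by
  intro x₀
  obtain ⟨s, a, ha, has, hT⟩ := (localSpan_word x₀ L).exists_finset
  refine ⟨(chartAt E x₀).source, (chartAt E x₀).open_source.mem_nhds (mem_chart_source E x₀),
    subset_rfl, s.sup Sigma.fst + 1, fun k i y => a ⟨k, i⟩ (chartAt E x₀ y), fun k i => ?_,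
    fun f y hy => ?_⟩
  · exact (ha ⟨k, i⟩).contMDiffOn.comp (contMDiffOn_chart (I := 𝓘(ℝ, E)) (n := ∞) (x := x₀))
      (fun y hy => (chartAt E x₀).map_source hy)
  · have h1 := hT f _ ((chartAt E x₀).map_source hy)
    rw [(chartAt E x₀).left_inv hy] at h1
    have h2 := Finset.sum_sigma' (Finset.range (s.sup Sigma.fst + 1)) (fun _ => Finset.univ)
      (fun k i => a ⟨k, i⟩ (chartAt E x₀ y) * chartPartial x₀ i f y)
    refine (h1.trans ?_).trans h2.symm
    refine Finset.sum_subset (fun p hp => ?_) (fun p _ hp => ?_)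
    · simp only [Finset.mem_sigma, Finset.mem_range, Finset.mem_univ, and_true]
      exact Nat.lt_succ_of_le (Finset.le_sup (f := Sigma.fst) hp)
    · simp [has p hp]

theorem word_mem_invDiffOp (L : List (LieAlg E G)) : word L ∈ InvDiffOp E G :=
  ⟨isDiffOp_word L, word_mul_leftTranslate L⟩

theorem wordSpan_le_invDiffOp (N : ℕ) : wordSpan E G N ≤ InvDiffOp E G :=
  Submodule.span_le.2 fun _ ⟨L, _, hD⟩ => hD ▸ word_mem_invDiffOp L

end Words

/-! ### Left invariant differential operators are spanned by words -/

section Generation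

variable {E : Type*} [NormedAddCommGroup E] [NormedSpace ℝ E] [FiniteDimensional ℝ E]
  {G : Type*} [TopologicalSpace G] [ChartedSpace E G] [Group G] [LieGroup 𝓘(ℝ, E) ∞ G]

variable (E G) in
/-- The words, read in the chart at the identity. -/
noncomputable def chartWords : Set (SmoothFun E G → E → ℂ) :=
  Set.range fun (L : List (LieAlg E G)) f v => (word L f).1 ((chartAt E (1 : G)).symm v)

variable (E G) in
/-- The points of the chart at the identity at which the vector fields `chartField 1 · X` form a
frame. -/
def frameDomain : Set E :=
  (chartAt E (1 : G)).target ∩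
    chartField (1 : G) ⁻¹' Set.range ((↑) : (E ≃L[ℝ] E) → E →L[ℝ] E)

theorem isOpen_frameDomain : IsOpen (frameDomain E G) :=
  (contDiffOn_chartField (1 : G)).continuousOn.isOpen_inter_preimage
    (chartAt E (1 : G)).open_target ContinuousLinearEquiv.isOpen

theorem one_mem_frameDomain : chartAt E (1 : G) 1 ∈ frameDomain E G :=
  ⟨(chartAt E (1 : G)).map_source (mem_chart_source E (1 : G)),
    ContinuousLinearEquiv.refl ℝ E, chartField_one.symm⟩

theorem contDiffOn_chartWords : ∀ D ∈ chartWords E G, ∀ f : SmoothFun E G,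
    ContDiffOn ℝ ∞ (D f) (frameDomain E G) := by
  rintro _ ⟨L, rfl⟩ f
  exact ((word L f).contDiffOn_chart 1).mono Set.inter_subset_left

theorem contDiffOn_inverse_chartField : ContDiffOn ℝ ∞
    (fun v => (chartField (E := E) (1 : G) v).inverse) (frameDomain E G) := by
  rintro v ⟨hv, e, he⟩
  have h1 := (contDiffOn_chartField (E := E) (1 : G)).contDiffAt
    ((chartAt E (1 : G)).open_target.mem_nhds hv)
  have h2 := contDiffAt_map_inverse (𝕜 := ℝ) (n := ∞) e
  rw [he] at h2
  exact (h2.comp v h1).contDiffWithinAt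

/-- On the frame domain a coordinate derivative is a smooth combination of left invariant vector
fields, with coefficients read off from the inverse of `chartField`. -/
theorem localSpan_fderiv_chartWords (x : E) : ∀ D ∈ chartWords E G,
    LocalSpan (frameDomain E G) (chartWords E G)
      fun f v => fderiv ℝ (D f) v x := by
  rintro _ ⟨L, rfl⟩
  set B := Module.finBasis ℝ E
  refine (LocalSpan.sum Finset.univ (T := fun j f v =>
    ((B.repr ((chartField (E := E) (1 : G) v).inverse x) j : ℝ) : ℂ) *
      (word ((show LieAlg E G from B j) :: L) f).1 ((chartAt E (1 : G)).symm v))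
      fun j _ => ?_).congr fun f v hv => ?_
  · refine LocalSpan.smul ?_ (LocalSpan.of_mem (Set.mem_range_self (f := fun
      (L : List (LieAlg E G)) f v => (word L f).1 ((chartAt E (1 : G)).symm v)) _))
    have h1 : ContDiff ℝ ∞ fun w : E => ((B.repr w j : ℝ) : ℂ) :=
      (Complex.ofRealCLM ∘L LinearMap.toContinuousLinearMap (B.coord j)).contDiff
    exact h1.comp_contDiffOn (contDiffOn_inverse_chartField.clm_apply contDiffOn_const)
  · obtain ⟨hv, e, he⟩ := hv
    have h1 : chartField (E := E) (1 : G) v ((chartField (E := E) (1 : G) v).inverse x) = x := by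
      rw [← he, ContinuousLinearMap.inverse_equiv]
      exact e.apply_symm_apply x
    conv_rhs => rw [← h1, ← B.sum_repr ((chartField (E := E) (1 : G) v).inverse x)]
    rw [map_sum, map_sum]
    refine Finset.sum_congr rfl fun j _ => ?_
    rw [map_smul, map_smul, word_cons, Complex.real_smul]
    congr 1
    exact leftInvReal_chart (1 : G) (B j) (word L f) hv

/-- On the frame domain every partial derivative is a smooth combination of words. -/
theorem localSpan_iteratedFDeriv (k : ℕ) (m : Fin k → E) :
    LocalSpan (frameDomain E G) (chartWords E G) fun f v =>
      iteratedFDeriv ℝ k (fun v : E => f.1 ((chartAt E (1 : G)).symm v)) v m := by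
  induction k with
  | zero =>
    refine (LocalSpan.of_mem (Set.mem_range_self (f := fun
      (L : List (LieAlg E G)) f v => (word L f).1 ((chartAt E (1 : G)).symm v)) [])).congr
      fun f v hv => ?_
    exact (iteratedFDeriv_zero_apply (𝕜 := ℝ)
      (f := fun v : E => f.1 ((chartAt E (1 : G)).symm v)) (x := v) m).symm
  | succ k ih =>
    refine ((ih (Fin.tail m)).fderiv isOpen_frameDomain contDiffOn_chartWords
      (contDiffOn_const (c := m 0)) (localSpan_fderiv_chartWords _)).congr fun f v hv => ?_
    rw [fderiv_iteratedFDeriv_apply ((f.contDiffOn_chart 1).contDiffAt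
      ((chartAt E (1 : G)).open_target.mem_nhds hv.1)), Fin.cons_self_tail]

theorem LocalSpan.exists_word {T : SmoothFun E G → E → ℂ}
    (h : LocalSpan (frameDomain E G) (chartWords E G) T) :
    ∃ N, ∃ P ∈ wordSpan E G N, ∀ f, T f (chartAt E (1 : G) 1) = (P f).1 1 := by
  induction h with
  | zero => exact ⟨0, 0, zero_mem _, fun f => rfl⟩
  | @smul_add a D T _ hD _ ih =>
    obtain ⟨N, P, hP, hT⟩ := ih
    obtain ⟨L, rfl⟩ := hD
    refine ⟨max N (L.length + 1), a (chartAt E (1 : G) 1) • word L + P,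
      add_mem (Submodule.smul_mem _ _ (word_mem_wordSpan L (by omega)))
        (wordSpan_mono (le_max_left _ _) hP), fun f => ?_⟩
    have h1 : ((a (chartAt E (1 : G) 1) • word L + P) f).1 1 =
      a (chartAt E (1 : G) 1) * (word L f).1 1 + (P f).1 1 := rfl
    rw [h1, ← hT f]
    change a _ * (word L f).1 ((chartAt E (1 : G)).symm (chartAt E (1 : G) 1)) + _ = _
    rw [(chartAt E (1 : G)).left_inv (mem_chart_source E (1 : G))]
  | congr _ h ih =>
    obtain ⟨N, P, hP, hT⟩ := ih
    exact ⟨N, P, hP, fun f => (h f _ one_mem_frameDomain).symm.trans (hT f)⟩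

/-- `𝔻(G)` is spanned by the words. Near the identity the partial derivatives are combinations of
words, so that at the identity `D` agrees with a combination of words with constant
coefficients; by left invariance they agree everywhere. -/
theorem exists_mem_wordSpan {D : Op E G} (hD : D ∈ InvDiffOp E G) : ∃ N, D ∈ wordSpan E G N := by
  obtain ⟨U, hU, -, M, a, -, h⟩ := hD.1 1
  have h1 : LocalSpan (frameDomain E G) (chartWords E G) fun f v =>
      ∑ k ∈ Finset.range M, ∑ i, a k i 1 *
        iteratedFDeriv ℝ k (fun v : E => f.1 ((chartAt E (1 : G)).symm v)) v
          (fun l => Module.finBasis ℝ E (i l)) :=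
    LocalSpan.sum _ fun k _ => LocalSpan.sum _ fun i _ =>
      (localSpan_iteratedFDeriv k _).smul contDiffOn_const
  obtain ⟨N, P, hP, hT⟩ := h1.exists_word
  refine ⟨N, ?_⟩
  rwa [op_ext_of_leftInvariant hD.2 (wordSpan_mul_leftTranslate hP)
    fun f => (h f 1 (mem_of_mem_nhds hU)).trans (hT f)]

end Generation

section WordAlgebra

variable {E : Type*} [NormedAddCommGroup E] [NormedSpace ℝ E] [FiniteDimensional ℝ E]
  {G : Type*} [TopologicalSpace G] [ChartedSpace E G] [Group G] [LieGroup 𝓘(ℝ, E) ∞ G]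

theorem word_mul_mem_wordSpan (L : List (LieAlg E G)) {N : ℕ} {D : Op E G}
    (hD : D ∈ wordSpan E G N) : word L * D ∈ wordSpan E G (L.length + N) := by
  induction hD using Submodule.span_induction with
  | mem D h =>
    obtain ⟨L', hL', rfl⟩ := h
    rw [← word_append]
    exact word_mem_wordSpan _ (by simpa using hL')
  | zero => simp
  | add D D' _ _ h h' => rw [mul_add]; exact add_mem h h'
  | smul c D _ h => rw [mul_smul_comm]; exact Submodule.smul_mem _ _ h

theorem adOp_word (g : G) (L : List (LieAlg E G)) : adOp g (word L) = word (L.map (Ad g)) := by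
  induction L with
  | nil => simp
  | cons X L ih => simp [ih, adOp_leftInvReal]

theorem adOp_mem_wordSpan (g : G) {N : ℕ} {D : Op E G} (hD : D ∈ wordSpan E G N) :
    adOp g D ∈ wordSpan E G N := by
  induction hD using Submodule.span_induction with
  | mem D h =>
    obtain ⟨L, hL, rfl⟩ := h
    rw [adOp_word]
    exact word_mem_wordSpan _ (by simpa using hL)
  | zero => simp
  | add D D' _ _ h h' => rw [map_add]; exact add_mem h h'
  | smul c D _ h => rw [map_smul]; exact Submodule.smul_mem _ _ h

theorem adOp_mem_invDiffOp (g : G) {D : Op E G} (hD : D ∈ InvDiffOp E G) :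
    adOp g D ∈ InvDiffOp E G := by
  obtain ⟨N, hN⟩ := exists_mem_wordSpan hD
  exact wordSpan_le_invDiffOp _ (adOp_mem_wordSpan g hN)

/-- Modulo shorter words, the letters of a word commute. -/
theorem word_sub_word_mem_of_perm {L L' : List (LieAlg E G)} (h : L.Perm L') :
    word L - word L' ∈ wordSpan E G L.length := by
  induction h with
  | nil => simp
  | cons X _ ih =>
    rw [word_cons, word_cons, ← mul_sub]
    have h1 := word_mul_mem_wordSpan [X] ih
    rw [word_cons, word_nil, mul_one] at h1
    exact wordSpan_mono (by simp; omega) h1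
  | swap X Y L =>
    obtain ⟨Z, hZ⟩ := exists_leftInvReal_commutator Y X
    have h1 : word (Y :: X :: L) - word (X :: Y :: L) = word (Z :: L) := by
      rw [word_cons, word_cons, word_cons, word_cons, word_cons, ← hZ, sub_mul, mul_assoc,
        mul_assoc]
    rw [h1]
    exact word_mem_wordSpan _ (by simp)
  | trans h₁ _ ih₁ ih₂ =>
    rw [← h₁.length_eq] at ih₂
    simpa using add_mem ih₁ ih₂

end WordAlgebra

/-! ### Smoothness of integrals over a compact set of parameters -/

section ParametricIntegral

variable {E : Type*} [NormedAddCommGroup E] [NormedSpace ℝ E] [FiniteDimensional ℝ E]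
  {G : Type*} [TopologicalSpace G] [ChartedSpace E G] [IsManifold 𝓘(ℝ, E) ∞ G]

/-- The partial derivative in the first variable of a smooth function on `U × G` is smooth. -/
theorem contMDiffOn_fderiv_left {U : Set E} (hU : IsOpen U) {Φ : E → G → ℂ}
    (hΦ : ContMDiffOn (𝓘(ℝ, E).prod 𝓘(ℝ, E)) 𝓘(ℝ, ℂ) ∞ (Function.uncurry Φ) (U ×ˢ Set.univ)) :
    ContMDiffOn (𝓘(ℝ, E).prod 𝓘(ℝ, E)) 𝓘(ℝ, E →L[ℝ] ℂ) ∞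
      (fun p : E × G => fderiv ℝ (fun v => Φ v p.2) p.1) (U ×ˢ Set.univ) := by
  intro p hp
  have h1 : ContMDiffAt ((𝓘(ℝ, E).prod 𝓘(ℝ, E)).prod 𝓘(ℝ, E)) 𝓘(ℝ, ℂ) ∞
      (Function.uncurry fun (q : E × G) (v : E) => Φ v q.2) (p, p.1) := by
    have h2 : ContMDiffAt (𝓘(ℝ, E).prod 𝓘(ℝ, E)) 𝓘(ℝ, ℂ) ∞ (Function.uncurry Φ) (p.1, p.2) :=
      hΦ.contMDiffAt ((hU.prod isOpen_univ).mem_nhds hp)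
    exact ContMDiffAt.comp (p, p.1) (f := fun r : (E × G) × E => (r.2, r.1.2)) h2
      (contMDiffAt_snd.prodMk contMDiffAt_fst.snd)
  have h3 := ContMDiffAt.mfderiv (x₀ := p) (m := ∞) (fun (q : E × G) (v : E) => Φ v q.2)
    (fun q : E × G => q.1) h1 contMDiffAt_fst (by simp)
  simp only [mfderiv_eq_fderiv] at h3
  have h4 := inTangentCoordinates_model_space (I := 𝓘(ℝ, E)) (I' := 𝓘(ℝ, ℂ))
    (fun q : E × G => q.1) (fun q => Φ q.1 q.2) (fun q => fderiv ℝ (fun v => Φ v q.2) q.1) p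
  exact (h3.congr_of_eventuallyEq (Filter.EventuallyEq.of_eq h4.symm)).contMDiffWithinAt

variable {Y : Type*} [TopologicalSpace Y] [T2Space Y] [MeasurableSpace Y] [BorelSpace Y]
  {μ : MeasureTheory.Measure Y} [MeasureTheory.IsFiniteMeasureOnCompacts μ]

open MeasureTheory in
theorem hasFDerivAt_integral_of_compact {U : Set E} (hU : IsOpen U) {Φ : E → G → ℂ}
    (hΦ : ContMDiffOn (𝓘(ℝ, E).prod 𝓘(ℝ, E)) 𝓘(ℝ, ℂ) ∞ (Function.uncurry Φ) (U ×ˢ Set.univ))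
    {i : Y → G} (hi : Continuous i) {c : Y → ℂ} (hc : Continuous c) {K : Set Y} (hK : IsCompact K)
    (h0 : ∀ v ∈ U, ∀ y ∉ K, Φ v (i y) = 0) {v₀ : E} (hv₀ : v₀ ∈ U) :
    HasFDerivAt (fun v => ∫ y, c y * Φ v (i y) ∂μ)
      (∫ y, c y • fderiv ℝ (fun v => Φ v (i y)) v₀ ∂μ) v₀ := by
  obtain ⟨ε, hε, hεU⟩ := Metric.nhds_basis_closedBall.mem_iff.1 (hU.mem_nhds hv₀)
  have hd0 : ∀ v ∈ U, ∀ y ∉ K, fderiv ℝ (fun v => Φ v (i y)) v = 0 := by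
    intro v hv y hy
    have : (fun v => Φ v (i y)) =ᶠ[𝓝 v] fun _ => 0 := by
      filter_upwards [hU.mem_nhds hv] with w hw using h0 w hw y hy
    rw [this.fderiv_eq]
    simp
  have hsl : ∀ v ∈ U, Continuous fun y => Φ v (i y) := fun v hv =>
    hΦ.continuousOn.comp_continuous (continuous_const.prodMk hi) fun y => ⟨hv, Set.mem_univ _⟩
  have hdc := (contMDiffOn_fderiv_left hU hΦ).continuousOn
  have hdsl : ∀ v ∈ U, Continuous fun y => fderiv ℝ (fun v => Φ v (i y)) v := fun v hv =>
    hdc.comp_continuous (continuous_const.prodMk hi) fun y => ⟨hv, Set.mem_univ _⟩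
  have hint : ∀ v ∈ U, Integrable (fun y => c y * Φ v (i y)) μ := fun v hv =>
    (hc.mul (hsl v hv)).integrable_of_hasCompactSupport
      (HasCompactSupport.intro hK fun y hy => by simp [h0 v hv y hy])
  obtain ⟨C, hC⟩ := ((isCompact_closedBall v₀ ε).prod hK).exists_bound_of_continuousOn
    (f := fun p : E × Y => c p.2 • fderiv ℝ (fun v => Φ v (i p.2)) p.1)
    ((hc.comp continuous_snd).continuousOn.smul (hdc.comp
      (continuous_fst.prodMk (hi.comp continuous_snd)).continuousOn
      fun p hp => ⟨hεU hp.1, Set.mem_univ _⟩))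
  refine hasFDerivAt_integral_of_dominated_of_fderiv_le (𝕜 := ℝ) (μ := μ)
    (F := fun v y => c y * Φ v (i y)) (F' := fun v y => c y • fderiv ℝ (fun v => Φ v (i y)) v)
    (bound := K.indicator fun _ => C) (Metric.closedBall_mem_nhds v₀ hε) ?_
    (hint v₀ hv₀) ?_ ?_ ?_ ?_
  · filter_upwards [hU.mem_nhds hv₀] with v hv using (hint v hv).aestronglyMeasurable
  · exact ((hc.smul (hdsl v₀ hv₀)).integrable_of_hasCompactSupport
      (HasCompactSupport.intro hK fun y hy =>
        ContinuousLinearMap.ext fun x => (congrArg (fun L : E →L[ℝ] ℂ => c y * L x)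
          (hd0 v₀ hv₀ y hy)).trans (mul_zero _))).aestronglyMeasurable
  · refine Filter.Eventually.of_forall fun y v hv => ?_
    by_cases hy : y ∈ K
    · simpa [hy] using hC (v, y) ⟨hv, hy⟩
    · simp [hy, hd0 v (hεU hv) y hy]
  · exact (integrable_indicator_iff hK.measurableSet).2 (integrableOn_const hK.measure_lt_top.ne)
  · refine Filter.Eventually.of_forall fun y v hv => ?_
    have h1 : ContMDiffAt 𝓘(ℝ, E) 𝓘(ℝ, ℂ) ∞ (fun v => Φ v (i y)) v :=
      ContMDiffAt.comp v (f := fun v : E => (v, i y))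
        (hΦ.contMDiffAt ((hU.prod isOpen_univ).mem_nhds ⟨hεU hv, Set.mem_univ _⟩))
        (contMDiffAt_id.prodMk contMDiffAt_const)
    exact (h1.contDiffAt.differentiableAt (by simp)).hasFDerivAt.const_mul (c y)

open MeasureTheory in
/-- An integral `∫ c(y) Φ(v, i(y)) dμ(y)` is smooth in `v`. The partial derivatives of `Φ` in `v`
satisfy the same hypotheses as `Φ`, which makes an induction on the order possible. -/
theorem contDiffOn_integral_of_compact {U : Set E} (hU : IsOpen U) {Φ : E → G → ℂ}
    (hΦ : ContMDiffOn (𝓘(ℝ, E).prod 𝓘(ℝ, E)) 𝓘(ℝ, ℂ) ∞ (Function.uncurry Φ) (U ×ˢ Set.univ))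
    {i : Y → G} (hi : Continuous i) {c : Y → ℂ} (hc : Continuous c) {K : Set Y} (hK : IsCompact K)
    (h0 : ∀ v ∈ U, ∀ y ∉ K, Φ v (i y) = 0) :
    ContDiffOn ℝ ∞ (fun v => ∫ y, c y * Φ v (i y) ∂μ) U := by
  rw [contDiffOn_infty]
  intro n
  induction n generalizing Φ with
  | zero =>
    refine contDiffOn_zero.2 fun v hv => ?_
    exact (hasFDerivAt_integral_of_compact hU hΦ hi hc hK h0 hv).continuousAt.continuousWithinAt
  | succ n ih =>
    have hd : ∀ v ∈ U, _ := fun v hv =>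
      hasFDerivAt_integral_of_compact (μ := μ) hU hΦ hi hc hK h0 hv
    refine contDiffOn_succ_of_fderiv_apply (n := n)
      (fun v hv => (hd v hv).differentiableAt.differentiableWithinAt) (by simp) fun x => ?_
    have hdc := contMDiffOn_fderiv_left hU hΦ
    have hd0 : ∀ v ∈ U, ∀ y ∉ K, fderiv ℝ (fun v => Φ v (i y)) v = 0 := by
      intro v hv y hy
      have : (fun v => Φ v (i y)) =ᶠ[𝓝 v] fun _ => 0 := by
        filter_upwards [hU.mem_nhds hv] with w hw using h0 w hw y hy
      rw [this.fderiv_eq]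
      simp
    refine (ih (Φ := fun v g => fderiv ℝ (fun v => Φ v g) v x) ?_ ?_).congr fun v hv => ?_
    · exact hdc.clm_apply contMDiffOn_const
    · intro v hv y hy
      rw [hd0 v hv y hy]
      rfl
    · rw [fderivWithin_of_isOpen hU hv, (hd v hv).fderiv, ContinuousLinearMap.integral_apply]
      · rfl
      · have hdsl : Continuous fun y => fderiv ℝ (fun v => Φ v (i y)) v :=
          hdc.continuousOn.comp_continuous (continuous_const.prodMk hi)
            fun y => ⟨hv, Set.mem_univ _⟩
        exact (hc.smul hdsl).integrable_of_hasCompactSupport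
          (HasCompactSupport.intro hK fun y hy =>
            ContinuousLinearMap.ext fun x => (congrArg (fun L : E →L[ℝ] ℂ => c y * L x)
              (hd0 v hv y hy)).trans (mul_zero _))

end ParametricIntegral

/-! ### Equivariant functions by averaging over the subgroup -/

section Averaging

open MeasureTheory
open scoped Pointwise

variable {E : Type*} [NormedAddCommGroup E] [NormedSpace ℝ E] [FiniteDimensional ℝ E]
  {G : Type*} [TopologicalSpace G] [T2Space G] [ChartedSpace E G] [Group G]
  [LieGroup 𝓘(ℝ, E) ∞ G]

/-- Averaging over `H`: for `F` smooth with compact support, `g ↦ ∫ χ(h) F(g h) dh` belongs to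
`C^∞_{H,χ}(G)`. Near any point only a compact set of `h` contributes, since `H` is closed. -/
theorem exists_equivFun_integral {H : Subgroup G} (hH : IsClosed (H : Set G)) {χ : H →* ℂˣ}
    (hχ : Continuous χ) [MeasurableSpace H] [BorelSpace H] (μ : Measure H)
    [IsFiniteMeasureOnCompacts μ] [μ.IsMulLeftInvariant] {F : G → ℂ}
    (hF : ContMDiff 𝓘(ℝ, E) 𝓘(ℝ, ℂ) ∞ F) (hFc : HasCompactSupport F) :
    ∃ f ∈ EquivFun (E := E) H χ, ∀ g, f.1 g = ∫ h : H, ((χ h : ℂˣ) : ℂ) * F (g * h) ∂μ := by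
  have hG : IsTopologicalGroup G := topologicalGroup_of_lieGroup 𝓘(ℝ, E) ∞
  set A : G → ℂ := fun g => ∫ h : H, ((χ h : ℂˣ) : ℂ) * F (g * h) ∂μ with hA
  have hsm : ContMDiff 𝓘(ℝ, E) 𝓘(ℝ, ℂ) ∞ A := by
    intro g₀
    set e := chartAt E g₀ with he
    have hv₀ : e g₀ ∈ e.target := e.map_source (mem_chart_source E g₀)
    obtain ⟨ε, hε, hεt⟩ := Metric.nhds_basis_closedBall.mem_iff.1 (e.open_target.mem_nhds hv₀)
    have hC : IsCompact (e.symm '' Metric.closedBall (e g₀) ε) :=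
      (isCompact_closedBall _ _).image_of_continuousOn (e.continuousOn_symm.mono hεt)
    have hK : IsCompact ((↑) ⁻¹' ((e.symm '' Metric.closedBall (e g₀) ε)⁻¹ * tsupport F) : Set H) :=
      hH.isClosedEmbedding_subtypeVal.isCompact_preimage (hC.inv.mul hFc)
    have hΦ : ContMDiffOn (𝓘(ℝ, E).prod 𝓘(ℝ, E)) 𝓘(ℝ, ℂ) ∞
        (Function.uncurry fun (v : E) (g : G) => F (e.symm v * g))
        (Metric.ball (e g₀) ε ×ˢ Set.univ) := by
      refine hF.comp_contMDiffOn (f := fun p : E × G => e.symm p.1 * p.2)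
        (ContMDiffOn.mul (ContMDiffOn.comp (t := e.target)
          (contMDiffOn_chart_symm (I := 𝓘(ℝ, E)) (n := ∞) (x := g₀)) contMDiffOn_fst ?_)
          contMDiffOn_snd)
      exact fun p hp => hεt (Metric.ball_subset_closedBall hp.1)
    -- For `v` in the ball, `F (e.symm v * h)` vanishes unless `h` lies in the compact set of `hK`.
    have h1 := contDiffOn_integral_of_compact (μ := μ) Metric.isOpen_ball hΦ
      (i := ((↑) : H → G)) continuous_subtype_val (c := fun h => ((χ h : ℂˣ) : ℂ))
      (Units.continuous_val.comp hχ) hK ?_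
    · have h2 : ContMDiffAt 𝓘(ℝ, E) 𝓘(ℝ, ℂ) ∞ (fun v => A (e.symm v)) (e g₀) :=
        (h1.contDiffAt (Metric.ball_mem_nhds _ hε)).contMDiffAt
      have h3 : ContMDiffAt 𝓘(ℝ, E) 𝓘(ℝ, E) ∞ e g₀ :=
        (contMDiffOn_chart (I := 𝓘(ℝ, E)) (n := ∞) (x := g₀)).contMDiffAt
          (e.open_source.mem_nhds (mem_chart_source E g₀))
      refine (h2.comp g₀ h3).congr_of_eventuallyEq ?_
      filter_upwards [e.open_source.mem_nhds (mem_chart_source E g₀)] with g hg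
      simp only [Function.comp_apply]
      rw [e.left_inv hg]
    · intro v hv h hh
      by_contra hne
      refine hh (Set.mem_mul.2 ⟨(e.symm v)⁻¹, Set.inv_mem_inv.2
        ⟨v, Metric.ball_subset_closedBall hv, rfl⟩, e.symm v * h, subset_tsupport _ hne, ?_⟩)
      exact inv_mul_cancel_left _ _
  refine ⟨⟨A, hsm⟩, fun g h₀ => ?_, fun g => rfl⟩
  change A (g * h₀) = A g * _
  have h1 := integral_mul_left_eq_self (μ := μ)
    (fun h : H => ((χ (h₀⁻¹ * h) : ℂˣ) : ℂ) * F (g * h)) h₀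
  have h2 : A (g * h₀) = ∫ h : H, ((χ (h₀⁻¹ * (h₀ * h)) : ℂˣ) : ℂ) * F (g * (h₀ * h : H)) ∂μ := by
    simp only [hA, inv_mul_cancel_left, Subgroup.coe_mul, mul_assoc]
  rw [h2, h1, mul_comm, hA, ← integral_const_mul]
  simp only [map_mul, Units.val_mul, mul_assoc]

/-- The average of a bump function at `g₀` is nonzero at `g₀` if its support is so small that
`χ` has positive real part where it matters. -/
theorem exists_equivFun_ne_zero {H : Subgroup G} (hH : IsClosed (H : Set G)) {χ : H →* ℂˣ}
    (hχ : Continuous χ) (g₀ : G) {W : Set G} (hW : W ∈ 𝓝 g₀)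
    (hre : ∀ h : H, g₀ * h ∈ W → 0 < ((χ h : ℂˣ) : ℂ).re) :
    ∃ f ∈ EquivFun (E := E) H χ, f.1 g₀ ≠ 0 ∧
      (∀ x : G, (∀ h : H, x * h ∉ W) → f.1 x = 0) ∧ (χ = 1 → ∀ x : G, (f.1 x).im = 0) := by
  have hG : IsTopologicalGroup G := topologicalGroup_of_lieGroup 𝓘(ℝ, E) ∞
  have hL : LocallyCompactSpace G :=
    Manifold.locallyCompact_of_finiteDimensional 𝓘(ℝ, E)
  have hLH : LocallyCompactSpace H := hH.isClosedEmbedding_subtypeVal.locallyCompactSpace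
  let : MeasurableSpace H := borel H
  have : BorelSpace H := ⟨rfl⟩
  obtain ⟨b, -, hb⟩ := (SmoothBumpFunction.nhds_basis_tsupport (I := 𝓘(ℝ, E)) g₀).mem_iff.1 hW
  have hbW : ∀ x, b x ≠ 0 → x ∈ W := fun x hx => hb (subset_tsupport _ hx)
  have hF : ContMDiff 𝓘(ℝ, E) 𝓘(ℝ, ℂ) ∞ fun x : G => ((b x : ℝ) : ℂ) :=
    Complex.ofRealCLM.contDiff.contMDiff.comp b.contMDiff
  have hFc : HasCompactSupport fun x : G => ((b x : ℝ) : ℂ) :=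
    b.hasCompactSupport.comp_left (g := ((↑) : ℝ → ℂ)) Complex.ofReal_zero
  obtain ⟨f, hf, hfi⟩ := exists_equivFun_integral (E := E) hH hχ
    (Measure.haar : Measure H) hF hFc
  refine ⟨f, hf, ?_, fun x hx => ?_, ?_⟩
  · have hc : Continuous fun h : H => ((χ h : ℂˣ) : ℂ) * ((b (g₀ * h) : ℝ) : ℂ) :=
      (Units.continuous_val.comp hχ).mul
        (hF.continuous.comp (continuous_const.mul continuous_subtype_val))
    have hK : HasCompactSupport fun h : H => ((χ h : ℂˣ) : ℂ) * ((b (g₀ * h) : ℝ) : ℂ) := by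
      refine HasCompactSupport.mul_left ?_
      exact hFc.comp_isClosedEmbedding
        ((Homeomorph.mulLeft g₀).isClosedEmbedding.comp hH.isClosedEmbedding_subtypeVal)
    have hi := hc.integrable_of_hasCompactSupport (μ := (Measure.haar : Measure H)) hK
    intro h0
    have h1 := congrArg Complex.re ((hfi g₀).symm.trans h0)
    have h2 := Complex.reCLM.integral_comp_comm hi
    have h3 : 0 < ∫ h : H, (((χ h : ℂˣ) : ℂ) * ((b (g₀ * h) : ℝ) : ℂ)).re ∂Measure.haar := by
      refine (Complex.continuous_re.comp hc).integral_pos_of_hasCompactSupport_nonneg_nonzero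
        (x := 1) (hK.comp_left (g := Complex.re) Complex.zero_re) (fun h => ?_) ?_
      · simp only [Pi.zero_apply, Complex.re_mul_ofReal]
        by_cases hb0 : b (g₀ * h) = 0
        · simp [hb0]
        · exact mul_nonneg (hre h (hbW _ hb0)).le b.nonneg
      · simp
    exact h3.ne' (h2.trans h1)
  · refine (hfi x).trans (integral_eq_zero_of_ae (Filter.Eventually.of_forall fun h => ?_))
    have : b (x * h) = 0 := by
      by_contra hne
      exact hx h (hbW _ hne)
    simp [this]
  · rintro rfl x
    have h1 := hfi x
    simp only [MonoidHom.one_apply, Units.val_one, one_mul] at h1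
    exact (congrArg Complex.im (h1.trans integral_ofReal)).trans (Complex.ofReal_im _)

theorem exists_equivFun_one {H : Subgroup G} (hH : IsClosed (H : Set G)) {χ : H →* ℂˣ}
    (hχ : Continuous χ) : ∃ f ∈ EquivFun (E := E) H χ, f.1 1 ≠ 0 := by
  have h1 : IsOpen {h : H | 0 < ((χ h : ℂˣ) : ℂ).re} :=
    isOpen_lt continuous_const (Complex.continuous_re.comp (Units.continuous_val.comp hχ))
  obtain ⟨W, hW, hWH⟩ := isOpen_induced_iff.1 h1
  have hmem : ∀ h : H, (h : G) ∈ W ↔ 0 < ((χ h : ℂˣ) : ℂ).re := fun h => by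
    have := Set.ext_iff.1 hWH h
    simpa using this
  obtain ⟨f, hf, hf1, -, -⟩ := exists_equivFun_ne_zero (E := E) hH hχ 1 (W := W)
    (hW.mem_nhds (by simpa using (hmem 1).2 (by simp)))
    (fun h hh => (hmem h).1 (by simpa using hh))
  exact ⟨f, hf, hf1⟩

/-- The right `H`-invariant functions separate the points outside `H` from the identity. -/
theorem exists_equivFun_separating {H : Subgroup G} (hH : IsClosed (H : Set G)) {g : G}
    (hg : g ∉ H) : ∃ f ∈ EquivFun (E := E) H (1 : H →* ℂˣ), f.1 g ≠ f.1 1 ∧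
      ∀ x : G, (f.1 x).im = 0 := by
  obtain ⟨f, hf, hf1, hf2, hf3⟩ := exists_equivFun_ne_zero (E := E) hH (χ := 1) continuous_const g
    (W := (H : Set G)ᶜ) (hH.isOpen_compl.mem_nhds hg) (fun h _ => by simp)
  exact ⟨f, hf, fun h => hf1 (h.trans (hf2 1 fun h hh => hh (by simp))), hf3 rfl⟩

end Averaging

/-! ### Existence of the curves exp(tX) -/

section ExpCurves

variable {E : Type*} [NormedAddCommGroup E] [NormedSpace ℝ E] [FiniteDimensional ℝ E]
  {G : Type*} [TopologicalSpace G] [ChartedSpace E G] [Group G] [LieGroup 𝓘(ℝ, E) ∞ G]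

theorem mfderiv_mul_left_mulInvariantVectorField (X : LieAlg E G) (g x : G) :
    (mfderiv 𝓘(ℝ, E) 𝓘(ℝ, E) (fun y : G => g * y) x : E →L[ℝ] E) (mulInvariantVectorField X x) =
      (mulInvariantVectorField X (g * x) : E) := by
  have hm : ∀ a b : G, MDifferentiableAt 𝓘(ℝ, E) 𝓘(ℝ, E) (fun y : G => a * y) b := fun a b =>
    ((contMDiff_mul_left (I := 𝓘(ℝ, E)) (n := ∞) (a := a)).mdifferentiable (by simp)) _
  have aux : ∀ (y : G) (L : E →L[ℝ] E), y = x →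
      HasMFDerivAt 𝓘(ℝ, E) 𝓘(ℝ, E) (fun y : G => g * y) x L →
      HasMFDerivAt 𝓘(ℝ, E) 𝓘(ℝ, E) (fun y : G => g * y) y L := by
    intro y L hy h
    subst hy
    exact h
  have h2 := HasMFDerivAt.comp (1 : G) (aux _ _ (mul_one _) (hm g x).hasMFDerivAt)
    (hm x 1).hasMFDerivAt
  have h3 : (fun y : G => g * y) ∘ (fun y : G => x * y) = fun y => g * x * y := by
    funext y
    simp only [Function.comp_apply, mul_assoc]
  rw [h3] at h2
  exact (congrArg (fun L : E →L[ℝ] E => L X) h2.mfderiv).symm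

theorem isMIntegralCurveOn_mul_left {X : LieAlg E G} {γ : ℝ → G} {s : Set ℝ}
    (h : IsMIntegralCurveOn (I := 𝓘(ℝ, E)) γ (mulInvariantVectorField X) s) (g : G) :
    IsMIntegralCurveOn (I := 𝓘(ℝ, E)) (fun t => g * γ t) (mulInvariantVectorField X) s := by
  intro t ht
  have hm : MDifferentiableAt 𝓘(ℝ, E) 𝓘(ℝ, E) (fun y : G => g * y) (γ t) :=
    ((contMDiff_mul_left (I := 𝓘(ℝ, E)) (n := ∞) (a := g)).mdifferentiable (by simp)) _
  have h1 := hm.hasMFDerivAt.comp_hasMFDerivWithinAt t (h t ht)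
  let A : E →L[ℝ] E := mfderiv 𝓘(ℝ, E) 𝓘(ℝ, E) (fun y : G => g * y) (γ t)
  let v : E := mulInvariantVectorField X (γ t)
  let w : E := mulInvariantVectorField X (g * γ t)
  have h2 : A v = w := mfderiv_mul_left_mulInvariantVectorField X g (γ t)
  have h3 : A ∘L (1 : ℝ →L[ℝ] ℝ).smulRight v = (1 : ℝ →L[ℝ] ℝ).smulRight w := by
    ext
    simp [h2]
  exact h1.congr_mfderiv h3

/-- The curve `t ↦ exp(tX)` exists for all times: left translation carries a local integral curve
at the identity to any other point, with the same interval of existence. -/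
theorem exists_isExpCurve [T2Space G] (X : LieAlg E G) : ∃ γ : ℝ → G, IsExpCurve X γ := by
  have : LieGroup 𝓘(ℝ, E) (minSmoothness ℝ 3) G := by
    refine LieGroup.of_le (n := ∞) ?_
    simpa using WithTop.coe_le_coe.2 (le_top : (3 : ℕ∞) ≤ ⊤)
  have : IsManifold 𝓘(ℝ, E) 1 G := IsManifold.of_le (n := ∞) (by simp)
  have : CompleteSpace E := FiniteDimensional.complete ℝ E
  have hv := (contMDiff_mulInvariantVectorField (I := 𝓘(ℝ, E)) (G := G) X).of_le (m := 1)
    (by simp)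
  obtain ⟨γ, hγ0, hγ⟩ := exists_isMIntegralCurveAt_of_contMDiffAt_boundaryless (I := 𝓘(ℝ, E)) 0
    (hv (1 : G))
  obtain ⟨ε, hε, hγε⟩ := isMIntegralCurveAt_iff'.1 hγ
  rw [Real.ball_eq_Ioo, zero_sub, zero_add] at hγε
  refine exists_isMIntegralCurve_of_isMIntegralCurveOn hv hε (fun x => ⟨fun t => x * γ t, ?_, ?_⟩) 1
  · exact (congrArg (x * ·) hγ0).trans (mul_one x)
  · exact isMIntegralCurveOn_mul_left hγε x

end ExpCurves

/-! ### The differential of the character and dual systems of functions -/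

section Equivariant

variable {E : Type*} [NormedAddCommGroup E] [NormedSpace ℝ E] [FiniteDimensional ℝ E]
  {G : Type*} [TopologicalSpace G] [T2Space G] [ChartedSpace E G] [Group G]
  [LieGroup 𝓘(ℝ, E) ∞ G]

theorem leftTranslate_mem_equivFun {H : Subgroup G} {χ : H →* ℂˣ} {f : SmoothFun E G}
    (hf : f ∈ EquivFun H χ) (g : G) : leftTranslate g f ∈ EquivFun H χ := by
  intro x h
  have := hf (g * x) h
  rw [mul_assoc] at this
  exact this

/-- A vector `X` that annihilates the right `H`-invariant functions at the identity lies in `𝔥`.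
By left invariance these functions are constant on `exp(tX)`, which therefore stays in `H`,
since they separate `H` from its complement. This takes the place of the closed subgroup
theorem. -/
theorem mem_lieSubalg_of_forall {H : Subgroup G} (hH : IsClosed (H : Set G)) {X : LieAlg E G}
    (hX : ∀ f ∈ EquivFun (E := E) H (1 : H →* ℂˣ), (∀ x : G, (f.1 x).im = 0) →
      (leftInvReal X f).1 1 = 0) : X ∈ lieSubalg H := by
  obtain ⟨γ, hγ⟩ := exists_isExpCurve X
  have hmem : ∀ t, γ t ∈ H := by
    intro t
    by_contra hg
    obtain ⟨f, hf, hne, him⟩ := exists_equivFun_separating (E := E) hH hg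
    have h1 : ∀ g, (leftInvReal X f).1 g = 0 := fun g => by
      have h2 := congrArg (fun T : Op E G => (T f).1 1) (leftTranslate_mul_leftInvReal g X)
      have h3 := hX (leftTranslate g f) (leftTranslate_mem_equivFun hf g) fun x => him (g * x)
      have h4 : (leftInvReal X f).1 (g * 1) = 0 := h2.symm.trans h3
      rwa [mul_one] at h4
    have h2 : ∀ t, HasDerivAt (fun t => f.1 (1 * γ t)) 0 t := fun t => by
      rw [← h1 (1 * γ t)]
      exact hγ.hasDerivAt f 1 t
    have h3 := is_const_of_deriv_eq_zero (fun t => (h2 t).differentiableAt)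
      (fun t => (h2 t).deriv) t 0
    rw [hγ.1, one_mul, one_mul] at h3
    exact hne h3
  exact Submodule.subset_span ⟨fun t => ⟨γ t, hmem t⟩, hγ⟩

/-- The character is differentiable along `exp(tX)`, because `χ(exp(tX)) = f(1) / f(exp(tX))` for
any smooth `f` in `C^∞_{H,χ}(G)` with `f(1) ≠ 0`. -/
theorem exists_hasDerivAt_character {H : Subgroup G} (hH : IsClosed (H : Set G)) {χ : H →* ℂˣ}
    (hχ : Continuous χ) {X : LieAlg E G} {γ : ℝ → H} (hγ : IsExpCurve X fun t => (γ t : G)) :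
    ∃ c : ℂ, HasDerivAt (fun t => ((χ (γ t) : ℂˣ) : ℂ)) c 0 := by
  obtain ⟨f, hf, hf1⟩ := exists_equivFun_one (E := E) hH hχ
  have h1 : ∀ t, f.1 (1 * γ t) = f.1 1 * ((χ (γ t) : ℂˣ) : ℂ)⁻¹ := fun t => by
    rw [hf 1 (γ t), map_inv, Units.val_inv_eq_inv_val]
  have h2 : (fun t => ((χ (γ t) : ℂˣ) : ℂ)) = fun t => f.1 1 * (f.1 (1 * γ t))⁻¹ := by
    funext t
    rw [h1 t, mul_inv, inv_inv, mul_inv_cancel_left₀ hf1]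
  rw [h2]
  refine ⟨_, ((hγ.hasDerivAt f 1 0).fun_inv ?_).const_mul (f.1 1)⟩
  rw [h1]
  exact mul_ne_zero hf1 (inv_ne_zero (Units.ne_zero _))

theorem hChi_apply_eq_zero {H : Subgroup G} {χ : H →* ℂˣ} {D : Op E G} (hD : D ∈ hChi H χ)
    {f : SmoothFun E G} (hf : f ∈ EquivFun H χ) : D f = 0 := by
  induction hD using Submodule.span_induction with
  | mem D h =>
    obtain ⟨X, γ, c, hγ, hc, rfl⟩ := h
    refine SmoothFun.ext' fun g => ?_
    have hγ0 : γ 0 = 1 := Subtype.ext hγ.1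
    have h1 := hγ.hasDerivAt f g 0
    have h2 : (fun t => f.1 (g * γ t)) = fun t => f.1 g * ((χ (γ t) : ℂˣ) : ℂ)⁻¹ := by
      funext t
      rw [hf g (γ t), map_inv, Units.val_inv_eq_inv_val]
    have h3 := (hc.fun_inv (Units.ne_zero _)).const_mul (f.1 g)
    rw [← h2] at h3
    have h4 := h1.unique h3
    rw [hγ0] at h4
    have e : (leftInvReal X f).1 (g * ((1 : H) : G)) = (leftInvReal X f).1 g := by simp
    change (leftInvReal X f).1 g + c * f.1 g = 0
    rw [← e, h4]
    simp
    ring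
  | zero => rfl
  | add D D' _ _ h h' => rw [LinearMap.add_apply, h, h', add_zero]
  | smul c D _ h => rw [LinearMap.smul_apply, h, smul_zero]

theorem leftIdealChi_apply_eq_zero {H : Subgroup G} {χ : H →* ℂˣ} {D : Op E G}
    (hD : D ∈ leftIdealChi H χ) {f : SmoothFun E G} (hf : f ∈ EquivFun H χ) : D f = 0 := by
  induction hD using Submodule.span_induction with
  | mem D h =>
    obtain ⟨v, -, w, hw, rfl⟩ := h
    change v (w f) = 0
    rw [hChi_apply_eq_zero hw hf, map_zero]
  | zero => rfl
  | add D D' _ _ h h' => rw [LinearMap.add_apply, h, h', add_zero]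
  | smul c D _ h => rw [LinearMap.smul_apply, h, smul_zero]

/-- For each `X ∈ 𝔥` there is a scalar `c`, playing the role of `dχ(X)`, with `X̃ + c ∈ 𝔥^χ`. -/
theorem exists_add_smul_mem_hChi {H : Subgroup G} (hH : IsClosed (H : Set G)) {χ : H →* ℂˣ}
    (hχ : Continuous χ) {X : LieAlg E G} (hX : X ∈ lieSubalg H) :
    ∃ c : ℂ, leftInvReal X + c • (1 : Op E G) ∈ hChi H χ := by
  induction hX using Submodule.span_induction with
  | mem X h =>
    obtain ⟨γ, hγ⟩ := h
    obtain ⟨c, hc⟩ := exists_hasDerivAt_character hH hχ hγ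
    exact ⟨c, Submodule.subset_span ⟨X, γ, c, hγ, hc, rfl⟩⟩
  | zero => exact ⟨0, by simp⟩
  | add X Y _ _ h h' =>
    obtain ⟨c, hc⟩ := h
    obtain ⟨c', hc'⟩ := h'
    refine ⟨c + c', ?_⟩
    have := add_mem hc hc'
    rwa [add_add_add_comm, ← map_add, ← add_smul] at this
  | smul a X _ h =>
    obtain ⟨c, hc⟩ := h
    refine ⟨(a : ℂ) * c, ?_⟩
    have h1 := Submodule.smul_mem _ (a : ℂ) hc
    rw [smul_add, smul_smul] at h1
    have h2 : ((a : ℂ) • leftInvReal X : Op E G) = leftInvReal (a • X) := by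
      rw [map_smul]
      rfl
    rwa [h2] at h1

theorem im_leftInvReal_eq_zero {f : SmoothFun E G} (hf : ∀ x : G, (f.1 x).im = 0) (X : LieAlg E G) :
    ((leftInvReal X f).1 1).im = 0 := by
  obtain ⟨γ, hγ⟩ := exists_isExpCurve X
  have h1 := hγ.hasDerivAt f 1 0
  have h2 := (Complex.imCLM.hasFDerivAt.comp_hasDerivAt (0 : ℝ) h1)
  have h3 : (Complex.imCLM ∘ fun t => f.1 (1 * γ t)) = fun _ => (0 : ℝ) := by
    funext t
    exact hf _
  rw [h3] at h2
  have h4 := h2.unique (hasDerivAt_const (0 : ℝ) (0 : ℝ))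
  rw [hγ.1, one_mul] at h4
  exact h4

variable (E G) in
/-- The constant function `c` on `G`. -/
def SmoothFun.const (c : ℂ) : SmoothFun E G := ⟨fun _ => c, contMDiff_const⟩

theorem leftInvReal_const (X : LieAlg E G) (c : ℂ) : leftInvReal X (SmoothFun.const E G c) = 0 := by
  refine SmoothFun.ext' fun g => ?_
  have h : mfderiv 𝓘(ℝ, E) 𝓘(ℝ, ℂ) (fun _ : G => c) 1 = 0 := mfderiv_const
  exact congrArg (fun L : E →L[ℝ] ℂ => L X) h

/-- For a basis `e` of `𝔪` there are right `H`-invariant functions `xⱼ` that vanish at the identity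
and satisfy `(ẽᵢ xⱼ)(1) = δᵢⱼ`. Otherwise the vectors `((ẽᵢ f)(1))ᵢ` would satisfy a complex
linear relation; testing it on real-valued `f` gives two real relations, hence two vectors of
`𝔪` that lie in `𝔥`. -/
theorem exists_dual_equivFun {H : Subgroup G} (hH : IsClosed (H : Set G))
    {𝔪 : Submodule ℝ (LieAlg E G)} (h𝔪 : Disjoint 𝔪 (lieSubalg H)) {r : ℕ}
    (e : Module.Basis (Fin r) ℝ 𝔪) (j : Fin r) :
    ∃ x ∈ EquivFun (E := E) H (1 : H →* ℂˣ), x.1 1 = 0 ∧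
      ∀ i, (leftInvReal (e i : LieAlg E G) x).1 1 = if i = j then 1 else 0 := by
  let T : EquivFun (E := E) H (1 : H →* ℂˣ) →ₗ[ℂ] (Fin r → ℂ) :=
    { toFun := fun f i => (leftInvReal (e i : LieAlg E G) f.1).1 1
      map_add' := fun f f' => funext fun i => by
        change (leftInvReal (e i : LieAlg E G) (f.1 + f'.1)).1 1 = _
        rw [map_add]
        rfl
      map_smul' := fun c f => funext fun i => by
        change (leftInvReal (e i : LieAlg E G) (c • f.1)).1 1 = _
        rw [map_smul]
        rfl }
  have hT : LinearMap.range T = ⊤ := by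
    by_contra hne
    obtain ⟨l, hl, hle⟩ := Submodule.exists_le_ker_of_lt_top _ (lt_top_iff_ne_top.2 hne)
    set a : Fin r → ℂ := fun i => l (Pi.single i 1) with ha
    have hla : ∀ w, l w = ∑ i, w i * a i := fun w => by
      rw [LinearMap.pi_apply_eq_sum_univ l w]
      refine Finset.sum_congr rfl fun i _ => ?_
      rw [smul_eq_mul, ha]
      congr 2
      funext k
      simp [Pi.single_apply, eq_comm]
    have key : ∀ b : Fin r → ℝ, (∀ f ∈ EquivFun (E := E) H (1 : H →* ℂˣ),
        (∀ x : G, (f.1 x).im = 0) →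
        ∑ i, ((leftInvReal (e i : LieAlg E G) f).1 1).re * b i = 0) → ∀ i, b i = 0 := by
      intro b hb
      have h1 : ((∑ i, b i • e i : 𝔪) : LieAlg E G) ∈ lieSubalg H := by
        refine mem_lieSubalg_of_forall hH fun f hf him => ?_
        refine Complex.ext ?_ (im_leftInvReal_eq_zero him _)
        rw [Complex.zero_re, ← hb f hf him, Submodule.coe_sum, map_sum]
        have h2 : ∀ s : Finset (Fin r), (((∑ i ∈ s,
            leftInvReal (E := E) (G := G) ((b i • e i : 𝔪) : LieAlg E G)) f).1 1).re =
            ∑ i ∈ s, ((leftInvReal (e i : LieAlg E G) f).1 1).re * b i := by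
          intro s
          induction s using Finset.cons_induction with
          | empty => rfl
          | cons i s hi ih =>
            rw [Finset.sum_cons, Finset.sum_cons, ← ih]
            have h3 : leftInvReal ((b i • e i : 𝔪) : LieAlg E G) =
              b i • leftInvReal (e i : LieAlg E G) := by rw [Submodule.coe_smul, map_smul]
            rw [h3]
            change (((b i : ℂ) * (leftInvReal (e i : LieAlg E G) f).1 1) + _).re = _
            rw [Complex.add_re, Complex.re_ofReal_mul, mul_comm]
        exact h2 Finset.univ
      have h4 : (∑ i, b i • e i : 𝔪) = 0 := by
        have := Submodule.disjoint_def.1 h𝔪 _ (Submodule.coe_mem _) h1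
        exact_mod_cast this
      exact Fintype.linearIndependent_iff.1 e.linearIndependent b h4
    have hz : ∀ f ∈ EquivFun (E := E) H (1 : H →* ℂˣ),
        ∑ i, (leftInvReal (e i : LieAlg E G) f).1 1 * a i = 0 := fun f hf => by
      rw [← hla]
      exact hle (LinearMap.mem_range_self T ⟨f, hf⟩)
    have hre := key (fun i => (a i).re) fun f hf him => by
      have h1 := congrArg Complex.re (hz f hf)
      simpa [Complex.re_sum, im_leftInvReal_eq_zero him] using h1
    have him := key (fun i => (a i).im) fun f hf him => by
      have h1 := congrArg Complex.im (hz f hf)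
      simpa [Complex.im_sum, im_leftInvReal_eq_zero him] using h1
    refine hl (LinearMap.ext fun w => ?_)
    rw [hla, LinearMap.zero_apply]
    exact Finset.sum_eq_zero fun i _ => by
      rw [Complex.ext (hre i) (him i) (w := (0 : ℂ)), mul_zero]
  obtain ⟨f, hf⟩ := LinearMap.range_eq_top.1 hT (Pi.single j 1)
  refine ⟨f.1 - SmoothFun.const E G (f.1.1 1), sub_mem f.2 ?_, ?_, fun i => ?_⟩
  · intro g h
    change f.1.1 1 = f.1.1 1 * _
    simp
  · exact sub_self _
  · rw [map_sub, leftInvReal_const, sub_zero]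
    have h1 := congrFun hf i
    rw [Pi.single_apply] at h1
    exact h1

end Equivariant

/-! ### Words applied to products of functions -/

section Leibniz

variable {E : Type*} [NormedAddCommGroup E] [NormedSpace ℝ E] [FiniteDimensional ℝ E]
  {G : Type*} [TopologicalSpace G] [ChartedSpace E G] [Group G] [LieGroup 𝓘(ℝ, E) ∞ G]

/-- The pointwise ring structure of `C^∞(G)`. -/
instance SmoothFun.instCommRing : CommRing (SmoothFun E G) :=
  { (inferInstance : AddCommGroup (SmoothFun E G)) with
    mul := fun f f' => ⟨fun x => f.1 x * f'.1 x,
      (contDiff_mul (𝕜 := ℝ) (𝔸 := ℂ) (n := ∞)).contMDiff.comp (f.2.prodMk_space f'.2)⟩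
    one := SmoothFun.const E G 1
    mul_assoc := fun _ _ _ => SmoothFun.ext' fun _ => mul_assoc _ _ _
    mul_comm := fun _ _ => SmoothFun.ext' fun _ => mul_comm _ _
    one_mul := fun _ => SmoothFun.ext' fun _ => one_mul _
    mul_one := fun _ => SmoothFun.ext' fun _ => mul_one _
    left_distrib := fun _ _ _ => SmoothFun.ext' fun _ => mul_add _ _ _
    right_distrib := fun _ _ _ => SmoothFun.ext' fun _ => add_mul _ _ _
    zero_mul := fun _ => SmoothFun.ext' fun _ => zero_mul _
    mul_zero := fun _ => SmoothFun.ext' fun _ => mul_zero _ }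

variable (E) in
/-- Evaluation of smooth functions at `g`. -/
def SmoothFun.eval (g : G) : SmoothFun E G →+* ℂ where
  toFun f := f.1 g
  map_one' := rfl
  map_mul' _ _ := rfl
  map_zero' := rfl
  map_add' _ _ := rfl

theorem SmoothFun.eval_smul (g : G) (c : ℂ) (f : SmoothFun E G) :
    SmoothFun.eval E g (c • f) = c * SmoothFun.eval E g f :=
  rfl

theorem leftInvReal_mul (X : LieAlg E G) (f f' : SmoothFun E G) :
    leftInvReal X (f * f') = f * leftInvReal X f' + leftInvReal X f * f' := by
  refine SmoothFun.ext' fun g => ?_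
  have h1 := HasMFDerivAt.mul (f.hasMFDerivAt_mul g) (f'.hasMFDerivAt_mul g)
  have h2 := congrArg (fun L : E →L[ℝ] ℂ => L X) h1.mfderiv
  refine Eq.trans h2 ?_
  change f.1 (g * 1) * (leftInvReal X f').1 g + f'.1 (g * 1) * (leftInvReal X f).1 g =
    f.1 g * (leftInvReal X f').1 g + (leftInvReal X f).1 g * f'.1 g
  rw [mul_one, mul_comm (f'.1 g)]

theorem leftInvReal_prod_mul {ι : Type*} [DecidableEq ι] (X : LieAlg E G) (s : Finset ι)
    (F : ι → SmoothFun E G) (f : SmoothFun E G) :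
    leftInvReal X ((∏ i ∈ s, F i) * f) =
      ∑ p ∈ s, (∏ i ∈ s.erase p, F i) * (leftInvReal X (F p) * f) +
        (∏ i ∈ s, F i) * leftInvReal X f := by
  induction s using Finset.induction_on generalizing f with
  | empty => simp
  | insert a s ha ih =>
    rw [Finset.prod_insert ha, mul_comm (F a), mul_assoc, ih, leftInvReal_mul,
      Finset.sum_insert ha, Finset.erase_insert ha]
    have h : ∀ p ∈ s, (∏ i ∈ (insert a s).erase p, F i) * (leftInvReal X (F p) * f) =
        (∏ i ∈ s.erase p, F i) * (leftInvReal X (F p) * (F a * f)) := by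
      intro p hp
      rw [Finset.erase_insert_of_ne (by rintro rfl; exact ha hp), Finset.prod_insert (by simp [ha])]
      ring
    rw [Finset.sum_congr rfl h]
    ring

/-- A word annihilates at the identity a product with more factors vanishing there than it has
letters. -/
theorem word_prod_mul_apply_one_of_lt {ι : Type*} [DecidableEq ι] (L : List (LieAlg E G))
    {s : Finset ι} (hL : L.length < s.card) {F : ι → SmoothFun E G}
    (hF : ∀ i, (F i).1 1 = 0) (f : SmoothFun E G) :
    SmoothFun.eval E 1 (word L ((∏ i ∈ s, F i) * f)) = 0 := by
  induction L using List.reverseRecOn generalizing s f with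
  | nil =>
    obtain ⟨i, hi⟩ := Finset.card_pos.1 (by simpa using hL)
    rw [word_nil, Module.End.one_apply, map_mul, map_prod, Finset.prod_eq_zero hi (hF i), zero_mul]
  | append_singleton L X ih =>
    rw [List.length_append, List.length_singleton] at hL
    rw [word_append, word_cons, word_nil, mul_one, Module.End.mul_apply, leftInvReal_prod_mul,
      map_add, map_add, ih (by omega), add_zero, map_sum, map_sum]
    refine Finset.sum_eq_zero fun p hp => ih ?_ _
    rw [Finset.card_erase_of_mem hp]
    omega

/-- A word of length `d`, applied to a product of `d` functions vanishing at the identity and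
another function `f`: at the identity only those terms of the Leibniz rule survive in which each
of the vanishing factors is differentiated once. The word is reversed so that its innermost letter,
on which the induction works, is `Y 0`. -/
theorem word_prod_mul_apply_one {d : ℕ} (Y : Fin d → LieAlg E G) {F : Fin d → SmoothFun E G}
    (hF : ∀ i, (F i).1 1 = 0) (f : SmoothFun E G) :
    SmoothFun.eval E 1 (word (List.ofFn Y).reverse ((∏ i, F i) * f)) =
      (∑ σ : Equiv.Perm (Fin d), ∏ k, SmoothFun.eval E 1 (leftInvReal (Y k) (F (σ k)))) *
        SmoothFun.eval E 1 f := by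
  induction d generalizing f with
  | zero => simp
  | succ d ih =>
    have h0 : SmoothFun.eval E 1 (word (List.ofFn (Fin.tail Y)).reverse
        ((∏ i, F i) * leftInvReal (Y 0) f)) = 0 :=
      word_prod_mul_apply_one_of_lt _ (by simp) hF _
    -- `k ↦ swap 0 p k.succ` enumerates the indices other than `p`, as in `decomposeFin`.
    have hp : ∀ p : Fin (d + 1), ∏ i ∈ Finset.univ.erase p, F i =
        ∏ k : Fin d, F (Equiv.swap 0 p k.succ) := by
      intro p
      have h1 : (Finset.univ.erase p : Finset (Fin (d + 1))) =
          Finset.univ.map ((Fin.succEmb d).trans (Equiv.swap 0 p).toEmbedding) := by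
        ext i
        simp only [Finset.mem_erase, Finset.mem_univ, and_true, Finset.mem_map, true_and,
          Function.Embedding.trans_apply, Equiv.coe_toEmbedding,
          Fin.coe_succEmb]
        constructor
        · intro hi
          have h2 : Equiv.swap 0 p i ≠ 0 := by
            intro h
            rw [Equiv.swap_apply_eq_iff, Equiv.swap_apply_left] at h
            exact hi h
          obtain ⟨k, hk⟩ := Fin.exists_succ_eq.2 h2
          exact ⟨k, by rw [hk, Equiv.swap_apply_self]⟩
        · rintro ⟨k, rfl⟩ h
          rw [Equiv.swap_apply_eq_iff, Equiv.swap_apply_right] at h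
          exact Fin.succ_ne_zero k h
      rw [h1, Finset.prod_map]
      rfl
    rw [List.ofFn_succ, List.reverse_cons, word_append, word_cons, word_nil, mul_one,
      Module.End.mul_apply, leftInvReal_prod_mul, map_add, map_add]
    refine (congrArg₂ (· + ·) rfl h0).trans ?_
    rw [add_zero, map_sum, map_sum, ← Equiv.sum_comp Equiv.Perm.decomposeFin.symm,
      Fintype.sum_prod_type, Finset.sum_mul]
    refine Finset.sum_congr rfl fun p _ => ?_
    rw [hp p, ih (fun k => Y k.succ) (F := fun k => F (Equiv.swap 0 p k.succ)) (fun k => hF _),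
      map_mul, Finset.sum_mul, Finset.sum_mul]
    refine Finset.sum_congr rfl fun σ _ => ?_
    rw [Fin.prod_univ_succ, Equiv.Perm.decomposeFin_symm_apply_zero]
    simp only [Equiv.Perm.decomposeFin_symm_apply_succ]
    ring

end Leibniz

/-! ### The symmetrization map on homogeneous elements -/

section Symbols

variable {E : Type*} [NormedAddCommGroup E] [NormedSpace ℝ E] [FiniteDimensional ℝ E]
  {G : Type*} [TopologicalSpace G] [ChartedSpace E G] [Group G] [LieGroup 𝓘(ℝ, E) ∞ G]

/-- A vector of `V` as an element of `S(V)`. -/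
noncomputable def symVec {V : Type*} [AddCommGroup V] [Module ℝ V] : V →ₗ[ℝ] SymC V :=
  (SymmetricAlgebra.ι ℂ (ℂ ⊗[ℝ] V)).restrictScalars ℝ ∘ₗ TensorProduct.mk ℝ ℂ V 1

theorem lam_prod {d : ℕ} (Y : Fin d → LieAlg E G) :
    lam E G (∏ k, symVec (Y k)) =
      ((d ! : ℕ) : ℂ)⁻¹ • ∑ σ : Equiv.Perm (Fin d), word (List.ofFn fun k => Y (σ k)) := by
  have h := symmetrization_prod (leftInv (E := E) (G := G)) fun k => 1 ⊗ₜ[ℝ] Y k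
  refine h.trans ?_
  simp only [symProd, leftInv, LinearMap.liftBaseChange_tmul, one_smul, word, List.map_ofFn]
  rfl

theorem lam_prod_apply_one {d : ℕ} (Y : Fin d → LieAlg E G) {F : Fin d → SmoothFun E G}
    (hF : ∀ i, (F i).1 1 = 0) (f : SmoothFun E G) :
    SmoothFun.eval E 1 (lam E G (∏ k, symVec (Y k)) ((∏ i, F i) * f)) =
      (∑ σ : Equiv.Perm (Fin d), ∏ k, SmoothFun.eval E 1 (leftInvReal (Y k) (F (σ k)))) *
        SmoothFun.eval E 1 f := by
  have h1 : ∀ τ : Equiv.Perm (Fin d), SmoothFun.eval E 1 (word (List.ofFn fun k => Y (τ k))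
      ((∏ i, F i) * f)) =
      (∑ σ : Equiv.Perm (Fin d), ∏ k, SmoothFun.eval E 1 (leftInvReal (Y k) (F (σ k)))) *
        SmoothFun.eval E 1 f := by
    intro τ
    have h2 : List.ofFn (fun k => Y (τ k)) = (List.ofFn fun k => Y (τ k.rev)).reverse := by
      refine List.ext_getElem (by simp) fun i h₁ h₂ => ?_
      rw [List.length_ofFn] at h₁
      simp only [List.getElem_ofFn, List.getElem_reverse, List.length_ofFn]
      congr 2
      ext
      simp only [Fin.val_rev]
      omega
    rw [h2, word_prod_mul_apply_one (fun k => Y (τ k.rev)) hF]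
    congr 1
    set ρ : Equiv.Perm (Fin d) := Fin.revPerm.trans τ with hρ
    refine Fintype.sum_equiv (Equiv.mulRight ρ⁻¹) _ _ fun σ => ?_
    rw [← Equiv.prod_comp ρ fun k =>
      SmoothFun.eval E 1 (leftInvReal (Y k) (F (Equiv.mulRight ρ⁻¹ σ k)))]
    refine Finset.prod_congr rfl fun k _ => ?_
    simp [hρ]
  rw [lam_prod]
  rw [LinearMap.smul_apply, SmoothFun.eval_smul, LinearMap.sum_apply, map_sum,
    Finset.sum_congr rfl fun τ _ => h1 τ,
    Finset.sum_const, Finset.card_univ, Fintype.card_perm, Fintype.card_fin, nsmul_eq_mul,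
    inv_mul_cancel_left₀ (Nat.cast_ne_zero.mpr (Nat.factorial_ne_zero d))]

/-- The homogeneous part of degree `d` of `S(M)`, inside `S(V)`. -/
noncomputable def homog {V : Type*} [AddCommGroup V] [Module ℝ V] (M : Submodule ℝ V) (d : ℕ) :
    Submodule ℂ (SymC V) :=
  Submodule.span ℂ {P | ∃ Y : Fin d → V, (∀ k, Y k ∈ M) ∧ P = ∏ k, symVec (Y k)}

/-- The elements of `S(M)` of degree less than `N`, inside `S(V)`. -/
noncomputable def degLT {V : Type*} [AddCommGroup V] [Module ℝ V] (M : Submodule ℝ V) (N : ℕ) :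
    Submodule ℂ (SymC V) :=
  Submodule.span ℂ {P | ∃ d < N, P ∈ homog M d}

theorem lam_apply_one_of_mem_degLT {M : Submodule ℝ (LieAlg E G)} {d : ℕ} {P : SymC (LieAlg E G)}
    (hP : P ∈ degLT M d) {F : Fin d → SmoothFun E G}
    (hF : ∀ i, (F i).1 1 = 0) (f : SmoothFun E G) :
    SmoothFun.eval E 1 (lam E G P ((∏ i, F i) * f)) = 0 := by
  induction hP using Submodule.span_induction with
  | mem P h =>
    obtain ⟨k, hk, h⟩ := h
    induction h using Submodule.span_induction with
    | mem P h =>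
      obtain ⟨Y, -, rfl⟩ := h
      rw [lam_prod, LinearMap.smul_apply, SmoothFun.eval_smul, LinearMap.sum_apply, map_sum,
        Finset.sum_eq_zero, mul_zero]
      exact fun σ _ => word_prod_mul_apply_one_of_lt _ (by simpa using hk) hF f
    | zero => rw [map_zero, LinearMap.zero_apply, map_zero]
    | add P P' _ _ h h' => rw [map_add, LinearMap.add_apply, map_add, h, h', add_zero]
    | smul c P _ h => rw [map_smul, LinearMap.smul_apply, SmoothFun.eval_smul, h, mul_zero]
  | zero => rw [map_zero, LinearMap.zero_apply, map_zero]
  | add P P' _ _ h h' => rw [map_add, LinearMap.add_apply, map_add, h, h', add_zero]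
  | smul c P _ h => rw [map_smul, LinearMap.smul_apply, SmoothFun.eval_smul, h, mul_zero]

/-- A homogeneous `Q ∈ S(𝔪)` of degree `d` is determined by the values of `λ(Q)` at the identity on
the products `x_{j(1)} ⋯ x_{j(d)} f`, where the `xⱼ` are dual to the basis `e`. -/
theorem factorial_smul_eq_sum {M : Submodule ℝ (LieAlg E G)} {r : ℕ}
    (e : Module.Basis (Fin r) ℝ M) {x : Fin r → SmoothFun E G} (hx : ∀ j, (x j).1 1 = 0)
    (hex : ∀ i j, (leftInvReal (e i : LieAlg E G) (x j)).1 1 = if i = j then 1 else 0)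
    (f : SmoothFun E G) {d : ℕ} {Q : SymC (LieAlg E G)} (hQ : Q ∈ homog M d) :
    ((d ! : ℕ) : ℂ) • SmoothFun.eval E 1 f • Q = ∑ j : Fin d → Fin r,
      SmoothFun.eval E 1 (lam E G Q ((∏ k, x (j k)) * f)) • ∏ k, symVec (e (j k) : LieAlg E G) := by
  have hexp : ∀ Y ∈ M, symVec (Y : LieAlg E G) =
      ∑ j, SmoothFun.eval E 1 (leftInvReal Y (x j)) • symVec (e j : LieAlg E G) := by
    intro Y hY
    have hrepr : Y = ∑ i, e.repr ⟨Y, hY⟩ i • (e i : LieAlg E G) := by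
      have := congrArg (Subtype.val) (e.sum_repr ⟨Y, hY⟩)
      rw [Submodule.coe_sum] at this
      exact this.symm
    have hc : ∀ j, SmoothFun.eval E 1 (leftInvReal Y (x j)) = ((e.repr ⟨Y, hY⟩ j : ℝ) : ℂ) := by
      intro j
      conv_lhs => rw [hrepr]
      rw [map_sum, LinearMap.sum_apply, map_sum, Finset.sum_eq_single j]
      · rw [map_smul]
        change ((e.repr ⟨Y, hY⟩ j : ℝ) : ℂ) * (leftInvReal (e j : LieAlg E G) (x j)).1 1 = _
        rw [hex, if_pos rfl, mul_one]
      · intro i _ hij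
        rw [map_smul]
        change ((e.repr ⟨Y, hY⟩ i : ℝ) : ℂ) * (leftInvReal (e i : LieAlg E G) (x j)).1 1 = _
        rw [hex, if_neg hij, mul_zero]
      · simp
    conv_lhs => rw [hrepr]
    rw [map_sum]
    refine Finset.sum_congr rfl fun j _ => ?_
    rw [map_smul, hc]
    rfl
  induction hQ using Submodule.span_induction with
  | mem Q h =>
    obtain ⟨Y, hY, rfl⟩ := h
    have h1 : ∀ σ : Equiv.Perm (Fin d), ∑ j : Fin d → Fin r,
        (∏ k, SmoothFun.eval E 1 (leftInvReal (Y k) (x (j (σ k))))) •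
          ∏ k, symVec (e (j k) : LieAlg E G) = ∏ k, symVec (Y k) := by
      intro σ
      rw [← Equiv.sum_comp (Equiv.arrowCongr σ (Equiv.refl (Fin r)))]
      have h2 : ∏ k, symVec (Y k) = ∏ k, ∑ j, SmoothFun.eval E 1 (leftInvReal (Y k) (x j)) •
          symVec (e j : LieAlg E G) := Finset.prod_congr rfl fun k _ => hexp _ (hY k)
      rw [h2, Finset.prod_univ_sum, Fintype.piFinset_univ]
      refine Finset.sum_congr rfl fun j _ => ?_
      rw [Finset.prod_smul, ← Equiv.prod_comp σ
        (fun k => symVec (e (Equiv.arrowCongr σ (Equiv.refl (Fin r)) j k) : LieAlg E G))]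
      simp [Equiv.arrowCongr]
    have h3 : ∀ j : Fin d → Fin r,
        SmoothFun.eval E 1 (lam E G (∏ k, symVec (Y k)) ((∏ k, x (j k)) * f)) •
          ∏ k, symVec (e (j k) : LieAlg E G) =
        SmoothFun.eval E 1 f • ∑ σ : Equiv.Perm (Fin d),
          (∏ k, SmoothFun.eval E 1 (leftInvReal (Y k) (x (j (σ k))))) •
            ∏ k, symVec (e (j k) : LieAlg E G) := fun j => by
      rw [lam_prod_apply_one Y (F := fun k => x (j k)) fun k => hx _, mul_comm, mul_smul,
        Finset.sum_smul]
    rw [Finset.sum_congr rfl fun j _ => h3 j, ← Finset.smul_sum, Finset.sum_comm,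
      Finset.sum_congr rfl fun σ _ => h1 σ, Finset.sum_const, Finset.card_univ,
      Fintype.card_perm, Fintype.card_fin, ← Nat.cast_smul_eq_nsmul ℂ, smul_comm]
  | zero => simp
  | add P P' _ _ h h' =>
    simp only [map_add, LinearMap.add_apply, smul_add, h, h', add_smul, Finset.sum_add_distrib]
  | smul c P _ h =>
    rw [smul_comm _ c P, smul_comm _ c, h, Finset.smul_sum]
    simp only [map_smul, LinearMap.smul_apply, SmoothFun.eval_smul, mul_smul]

end Symbols

/-! ### Degrees in the symmetric algebra -/

section SymGrading

variable {V W : Type*} [AddCommGroup V] [Module ℝ V] [AddCommGroup W] [Module ℝ W]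

theorem prod_symVec_mem_homog {M : Submodule ℝ V} {d : ℕ} {Y : Fin d → V} (hY : ∀ k, Y k ∈ M) :
    ∏ k, symVec (Y k) ∈ homog M d :=
  Submodule.subset_span ⟨Y, hY, rfl⟩

theorem homog_le_degLT {M : Submodule ℝ V} {d N : ℕ} (h : d < N) : homog M d ≤ degLT M N :=
  fun _ hP => Submodule.subset_span ⟨d, h, hP⟩

theorem degLT_mono {M : Submodule ℝ V} {N N' : ℕ} (h : N ≤ N') : degLT M N ≤ degLT M N' :=
  Submodule.span_mono fun _ ⟨d, hd, hP⟩ => ⟨d, hd.trans_le h, hP⟩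

theorem mul_mem_homog {M : Submodule ℝ V} {a b : ℕ} {P Q : SymC V} (hP : P ∈ homog M a)
    (hQ : Q ∈ homog M b) : P * Q ∈ homog M (a + b) := by
  have h := Submodule.mul_mem_mul hP hQ
  rw [homog, homog, Submodule.span_mul_span] at h
  refine Submodule.span_le.2 ?_ h
  rintro _ ⟨_, ⟨Y, hY, rfl⟩, _, ⟨Y', hY', rfl⟩, rfl⟩
  have h1 : ∏ k, symVec (Fin.append Y Y' k) = (∏ k, symVec (Y k)) * ∏ k, symVec (Y' k) := by
    simp [Fin.prod_univ_add]
  change (∏ k, symVec (Y k)) * ∏ k, symVec (Y' k) ∈ homog M (a + b)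
  rw [← h1]
  refine prod_symVec_mem_homog fun k => ?_
  refine Fin.addCases (fun i => ?_) (fun i => ?_) k
  · rw [Fin.append_left]; exact hY i
  · rw [Fin.append_right]; exact hY' i

theorem mul_mem_degLT {M : Submodule ℝ V} {a b : ℕ} {P Q : SymC V} (hP : P ∈ degLT M a)
    (hQ : Q ∈ degLT M b) : P * Q ∈ degLT M (a + b) := by
  have h := Submodule.mul_mem_mul hP hQ
  rw [degLT, degLT, Submodule.span_mul_span] at h
  refine Submodule.span_le.2 ?_ h
  rintro _ ⟨P, ⟨i, hi, hP⟩, Q, ⟨j, hj, hQ⟩, rfl⟩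
  exact homog_le_degLT (by omega) (mul_mem_homog hP hQ)

theorem degLT_zero (M : Submodule ℝ V) : degLT M 0 = ⊥ :=
  Submodule.span_eq_bot.2 fun _ ⟨_, hd, _⟩ => absurd hd (Nat.not_lt_zero _)

theorem exists_add_of_mem_degLT_succ {M : Submodule ℝ V} {d : ℕ} {P : SymC V}
    (hP : P ∈ degLT M (d + 1)) : ∃ Q ∈ homog M d, ∃ R ∈ degLT M d, P = Q + R := by
  have h : degLT M (d + 1) ≤ homog M d ⊔ degLT M d := by
    refine Submodule.span_le.2 ?_
    rintro P' ⟨k, hk, hP'⟩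
    rcases Nat.lt_succ_iff_lt_or_eq.1 hk with hk | hk
    · exact Submodule.mem_sup_right (homog_le_degLT hk hP')
    · exact Submodule.mem_sup_left (hk ▸ hP')
  obtain ⟨Q, hQ, R, hR, hQR⟩ := Submodule.mem_sup.1 (h hP)
  exact ⟨Q, hQ, R, hR, hQR.symm⟩

theorem map_symVec (T : V →ₗ[ℝ] W) (v : V) : SymC.map T (symVec v) = symVec (T v) :=
  SymC.map_ι T v

theorem map_mem_homog {T : V →ₗ[ℝ] W} {M : Submodule ℝ V} {M' : Submodule ℝ W}
    (hT : ∀ v ∈ M, T v ∈ M') {d : ℕ} {P : SymC V} (hP : P ∈ homog M d) :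
    SymC.map T P ∈ homog M' d := by
  induction hP using Submodule.span_induction with
  | mem P h =>
    obtain ⟨Y, hY, rfl⟩ := h
    rw [map_prod]
    simp only [map_symVec]
    exact prod_symVec_mem_homog fun k => hT _ (hY k)
  | zero => rw [map_zero]; exact zero_mem _
  | add P Q _ _ h h' => rw [map_add]; exact add_mem h h'
  | smul c P _ h => rw [map_smul]; exact Submodule.smul_mem _ _ h

theorem homog_le_sub (M : Submodule ℝ V) (d : ℕ) : homog M d ≤ (SymC.sub M).toSubmodule := by
  refine Submodule.span_le.2 ?_
  rintro _ ⟨Y, hY, rfl⟩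
  change ∏ k, symVec (Y k) ∈ SymC.sub M
  exact prod_mem fun k _ => ⟨symVec ⟨Y k, hY k⟩, map_symVec _ _⟩

theorem degLT_le_sub (M : Submodule ℝ V) (N : ℕ) : degLT M N ≤ (SymC.sub M).toSubmodule :=
  Submodule.span_le.2 fun _ ⟨d, _, hP⟩ => homog_le_sub M d hP

theorem exists_mem_degLT {M : Submodule ℝ V} {P : SymC V} (hP : P ∈ SymC.sub M) :
    ∃ N, P ∈ degLT M N := by
  obtain ⟨P, rfl⟩ := hP
  change ∃ N, SymC.map M.subtype P ∈ degLT M N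
  induction P using SymmetricAlgebra.induction with
  | algebraMap c =>
    refine ⟨1, homog_le_degLT one_pos ?_⟩
    rw [AlgHom.commutes, Algebra.algebraMap_eq_smul_one]
    refine Submodule.smul_mem _ _ ?_
    have := prod_symVec_mem_homog (M := M) (Y := (Fin.elim0 : Fin 0 → V)) fun k => k.elim0
    simpa using this
  | ι z =>
    refine ⟨2, homog_le_degLT one_lt_two ?_⟩
    induction z using TensorProduct.induction_on with
    | zero => rw [map_zero, map_zero]; exact zero_mem _
    | tmul c m =>
      have h1 : SymmetricAlgebra.ι ℂ (ℂ ⊗[ℝ] M) (c ⊗ₜ[ℝ] m) = c • symVec m := by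
        change _ = c • SymmetricAlgebra.ι ℂ (ℂ ⊗[ℝ] M) (1 ⊗ₜ[ℝ] m)
        rw [← map_smul, TensorProduct.smul_tmul', smul_eq_mul, mul_one]
      rw [h1, map_smul, map_symVec]
      refine Submodule.smul_mem _ _ ?_
      have := prod_symVec_mem_homog (M := M) (Y := fun _ : Fin 1 => (m : V)) fun _ => m.2
      simpa using this
    | add x y hx hy => rw [map_add, map_add]; exact add_mem hx hy
  | mul a b ha hb =>
    obtain ⟨N, hN⟩ := ha
    obtain ⟨N', hN'⟩ := hb
    exact ⟨N + N', by rw [map_mul]; exact mul_mem_degLT hN hN'⟩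
  | add a b ha hb =>
    obtain ⟨N, hN⟩ := ha
    obtain ⟨N', hN'⟩ := hb
    exact ⟨max N N', by
      rw [map_add]
      exact add_mem (degLT_mono (le_max_left _ _) hN) (degLT_mono (le_max_right _ _) hN')⟩

end SymGrading

/-! ### Reduction modulo the left ideal -/

section Reduction

variable {E : Type*} [NormedAddCommGroup E] [NormedSpace ℝ E] [FiniteDimensional ℝ E]
  {G : Type*} [TopologicalSpace G] [ChartedSpace E G] [Group G] [LieGroup 𝓘(ℝ, E) ∞ G]

theorem lam_prod_sub_word_mem {d : ℕ} (Y : Fin d → LieAlg E G) :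
    lam E G (∏ k, symVec (Y k)) - word (List.ofFn Y) ∈ wordSpan E G d := by
  have h1 : lam E G (∏ k, symVec (Y k)) - word (List.ofFn Y) = ((d ! : ℕ) : ℂ)⁻¹ •
      ∑ σ : Equiv.Perm (Fin d), (word (List.ofFn fun k => Y (σ k)) - word (List.ofFn Y)) := by
    rw [lam_prod, Finset.sum_sub_distrib, smul_sub, Finset.sum_const, Finset.card_univ,
      Fintype.card_perm, Fintype.card_fin, ← Nat.cast_smul_eq_nsmul ℂ, smul_smul,
      inv_mul_cancel₀ (Nat.cast_ne_zero.mpr (Nat.factorial_ne_zero d)), one_smul]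
  rw [h1]
  refine Submodule.smul_mem _ _ (sum_mem fun σ _ => ?_)
  have h2 := word_sub_word_mem_of_perm (Equiv.Perm.ofFn_comp_perm σ Y)
  simpa [Function.comp_def] using h2

theorem lam_mem_wordSpan_of_mem_homog {M : Submodule ℝ (LieAlg E G)} {d : ℕ}
    {P : SymC (LieAlg E G)} (hP : P ∈ homog M d) : lam E G P ∈ wordSpan E G (d + 1) := by
  induction hP using Submodule.span_induction with
  | mem P h =>
    obtain ⟨Y, -, rfl⟩ := h
    rw [lam_prod]
    exact Submodule.smul_mem _ _ (sum_mem fun σ _ => word_mem_wordSpan _ (by simp))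
  | zero => rw [map_zero]; exact zero_mem _
  | add P Q _ _ h h' => rw [map_add]; exact add_mem h h'
  | smul c P _ h => rw [map_smul]; exact Submodule.smul_mem _ _ h

theorem map_lam_degLT_le_wordSpan (M : Submodule ℝ (LieAlg E G)) (N : ℕ) :
    (degLT M N).map (lam E G) ≤ wordSpan E G N := by
  rw [Submodule.map_le_iff_le_comap]
  refine Submodule.span_le.2 ?_
  rintro P ⟨d, hd, hP⟩
  exact wordSpan_mono hd (lam_mem_wordSpan_of_mem_homog hP)

theorem lam_mem_invDiffOp {M : Submodule ℝ (LieAlg E G)} {P : SymC (LieAlg E G)}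
    (hP : P ∈ SymC.sub M) : lam E G P ∈ InvDiffOp E G := by
  obtain ⟨N, hN⟩ := exists_mem_degLT hP
  exact wordSpan_le_invDiffOp N (map_lam_degLT_le_wordSpan M N (Submodule.mem_map_of_mem hN))

theorem adOp_lam {M : Submodule ℝ (LieAlg E G)} {d : ℕ} {P : SymC (LieAlg E G)}
    (hP : P ∈ homog M d) (g : G) : adOp g (lam E G P) = lam E G (SymC.map (Ad g) P) := by
  induction hP using Submodule.span_induction with
  | mem P h =>
    obtain ⟨Y, -, rfl⟩ := h
    rw [map_prod (SymC.map (Ad g))]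
    simp only [map_symVec, lam_prod, map_smul, map_sum, adOp_word, List.map_ofFn,
      Function.comp_def]
  | zero => simp only [map_zero]
  | add P Q _ _ h h' => simp only [map_add, h, h']
  | smul c P _ h => simp only [map_smul, h]

variable [T2Space G] {H : Subgroup G} (hH : IsClosed (H : Set G)) {χ : H →* ℂˣ}
  (hχ : Continuous χ) {𝔪 : Submodule ℝ (LieAlg E G)} (h𝔪 : IsCompl 𝔪 (lieSubalg H))
include hH hχ

/-- A word with a letter `Z ∈ 𝔥` is a sum of shorter words and an element of `𝔻(G)𝔥^χ`: move `Z` to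
the right, where `Z̃ = (Z̃ + c) - c`. -/
theorem word_append_cons_mem {Z : LieAlg E G} (hZ : Z ∈ lieSubalg H) (A B : List (LieAlg E G)) :
    word (A ++ Z :: B) ∈ wordSpan E G (A ++ Z :: B).length ⊔ leftIdealChi H χ := by
  obtain ⟨c, hc⟩ := exists_add_smul_mem_hChi hH hχ hZ
  have hp : (A ++ Z :: B).Perm ((A ++ B) ++ [Z]) := by
    refine List.perm_middle.trans ?_
    exact (List.perm_append_singleton Z (A ++ B)).symm
  have h1 : word (A ++ Z :: B) = (word (A ++ Z :: B) - word ((A ++ B) ++ [Z])) +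
      (word (A ++ B) * (leftInvReal Z + c • 1) - c • word (A ++ B)) := by
    rw [word_append (A ++ B), word_cons Z [], word_nil, mul_one, mul_add, mul_smul_comm, mul_one]
    abel
  rw [h1]
  refine add_mem (Submodule.mem_sup_left (word_sub_word_mem_of_perm hp)) (sub_mem
    (Submodule.mem_sup_right (Submodule.subset_span ⟨_, word_mem_invDiffOp _, _, hc, rfl⟩))
    (Submodule.mem_sup_left (Submodule.smul_mem _ _ (word_mem_wordSpan _ ?_))))
  rw [hp.length_eq]
  simp

/-- Replacing the letters of a word by their projections to `𝔪` changes it by shorter words and an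
element of `𝔻(G)𝔥^χ`. -/
theorem word_append_sub_mem (A B : List (LieAlg E G)) :
    word (A ++ B) - word (A ++ B.map (𝔪.projection (lieSubalg H) h𝔪)) ∈
      wordSpan E G (A ++ B).length ⊔ leftIdealChi H χ := by
  induction B generalizing A with
  | nil => simp
  | cons Y B ih =>
    set σ := 𝔪.projection (lieSubalg H) h𝔪
    have h1 := ih (A ++ [Y])
    have h2 := word_append_cons_mem hH hχ (Submodule.sub_projection_mem h𝔪 Y) A (B.map σ)
    have h3 : word (A ++ (Y - σ Y) :: B.map σ) =
        word (A ++ Y :: B.map σ) - word (A ++ σ Y :: B.map σ) := by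
      simp only [word_append, word_cons, map_sub, sub_mul, mul_sub]
    rw [h3] at h2
    simp only [List.append_assoc, List.singleton_append] at h1
    have h4 : (A ++ (Y - σ Y) :: B.map σ).length = (A ++ Y :: B).length := by simp
    rw [h4] at h2
    have h5 := add_mem h1 h2
    rwa [sub_add_sub_cancel] at h5

theorem word_sub_lam_mem {d : ℕ} (Y : Fin d → LieAlg E G) :
    word (List.ofFn Y) - lam E G (∏ k, symVec (𝔪.projection (lieSubalg H) h𝔪 (Y k))) ∈
      wordSpan E G d ⊔ leftIdealChi H χ := by
  have h1 := word_append_sub_mem hH hχ h𝔪 [] (List.ofFn Y)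
  have h2 := lam_prod_sub_word_mem fun k => 𝔪.projection (lieSubalg H) h𝔪 (Y k)
  rw [List.nil_append, List.nil_append, List.map_ofFn, List.length_ofFn] at h1
  have h3 := sub_mem h1 (Submodule.mem_sup_left h2)
  simpa [Function.comp_def] using h3

include h𝔪 in
/-- Every operator of order less than `d` is congruent modulo `𝔻(G)𝔥^χ` to some `λ(P)` with
`P ∈ S(𝔪)` of degree less than `d`. -/
theorem wordSpan_le_sup (d : ℕ) :
    wordSpan E G d ≤ (degLT 𝔪 d).map (lam E G) ⊔ leftIdealChi H χ := by
  induction d with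
  | zero => exact Submodule.span_le.2 fun _ ⟨_, hL, _⟩ => absurd hL (Nat.not_lt_zero _)
  | succ d ih =>
    have ih' : wordSpan E G d ⊔ leftIdealChi H χ ≤
        (degLT 𝔪 (d + 1)).map (lam E G) ⊔ leftIdealChi H χ :=
      sup_le (ih.trans (sup_le_sup_right (Submodule.map_mono (degLT_mono d.le_succ)) _))
        le_sup_right
    refine Submodule.span_le.2 ?_
    rintro _ ⟨L, hL, rfl⟩
    rcases Nat.lt_succ_iff_lt_or_eq.1 hL with hL | hL
    · exact ih' (Submodule.mem_sup_left (word_mem_wordSpan L hL))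
    · subst hL
      have h1 := word_sub_lam_mem hH hχ h𝔪 L.get
      rw [List.ofFn_get] at h1
      have h2 : lam E G (∏ k, symVec (𝔪.projection (lieSubalg H) h𝔪 (L.get k))) ∈
          (degLT 𝔪 (L.length + 1)).map (lam E G) :=
        Submodule.mem_map_of_mem (homog_le_degLT (Nat.lt_succ_self _)
          (prod_symVec_mem_homog fun k => Submodule.projection_apply_mem h𝔪 _))
      have h3 := add_mem (ih' h1) (Submodule.mem_sup_left h2)
      rwa [sub_add_cancel] at h3

theorem lam_sub_lam_map_projection_mem {M : Submodule ℝ (LieAlg E G)} {d : ℕ}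
    {P : SymC (LieAlg E G)} (hP : P ∈ homog M d) :
    lam E G P - lam E G (SymC.map (𝔪.projection (lieSubalg H) h𝔪) P) ∈
      (degLT 𝔪 d).map (lam E G) ⊔ leftIdealChi H χ := by
  have hle := sup_le (wordSpan_le_sup hH hχ h𝔪 d)
    (le_sup_right : leftIdealChi H χ ≤ (degLT 𝔪 d).map (lam E G) ⊔ leftIdealChi H χ)
  induction hP using Submodule.span_induction with
  | mem P h =>
    obtain ⟨Y, -, rfl⟩ := h
    have h1 := add_mem (Submodule.mem_sup_left (lam_prod_sub_word_mem Y))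
      (word_sub_lam_mem hH hχ h𝔪 Y)
    rw [sub_add_sub_cancel] at h1
    rw [map_prod (SymC.map (𝔪.projection (lieSubalg H) h𝔪))]
    simp only [map_symVec]
    exact hle h1
  | zero => simp
  | add P Q _ _ h h' =>
    have := add_mem h h'
    rwa [sub_add_sub_comm, ← map_add, ← map_add, ← map_add] at this
  | smul c P _ h =>
    have := Submodule.smul_mem _ c h
    rwa [smul_sub, ← map_smul, ← map_smul, ← map_smul] at this

omit hH hχ in
theorem prod_mul_mem_equivFun {ι : Type*} (s : Finset ι) {x : ι → SmoothFun E G}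
    (hx : ∀ i, x i ∈ EquivFun H (1 : H →* ℂˣ)) {f : SmoothFun E G} (hf : f ∈ EquivFun H χ) :
    (∏ i ∈ s, x i) * f ∈ EquivFun H χ := by
  have h1 : ∀ x f : SmoothFun E G, x ∈ EquivFun H (1 : H →* ℂˣ) → f ∈ EquivFun H χ →
      x * f ∈ EquivFun H χ := fun x f hx hf g h => by
    change x.1 (g * h) * f.1 (g * h) = x.1 g * f.1 g * _
    rw [hx g h, hf g h]
    simp [mul_assoc]
  induction s using Finset.cons_induction generalizing f with
  | empty => simpa using hf
  | cons a s ha ih =>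
    rw [Finset.prod_cons, mul_comm (x a), mul_assoc]
    exact ih (h1 _ _ (hx a) hf)

include h𝔪 in
/-- If `λ(P)` annihilates `C^∞_{H,χ}(G)`, where `P ∈ S(𝔪)`, then the leading term of `P`
vanishes. -/
theorem eq_zero_of_lam_add_annihilates {d : ℕ} {Q R : SymC (LieAlg E G)} (hQ : Q ∈ homog 𝔪 d)
    (hR : R ∈ degLT 𝔪 d) (h : ∀ f ∈ EquivFun (E := E) H χ, lam E G (Q + R) f = 0) : Q = 0 := by
  have : FiniteDimensional ℝ (LieAlg E G) := inferInstanceAs (FiniteDimensional ℝ E)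
  let e := Module.finBasis ℝ 𝔪
  choose x hx hx1 hex using exists_dual_equivFun (E := E) hH h𝔪.disjoint e
  obtain ⟨f, hf, hf1⟩ := exists_equivFun_one (E := E) hH hχ
  have h1 := factorial_smul_eq_sum e hx1 (fun i j => hex j i) f hQ
  rw [Finset.sum_eq_zero] at h1
  · exact (smul_eq_zero.1 ((smul_eq_zero.1 h1).resolve_left
      (Nat.cast_ne_zero.mpr (Nat.factorial_ne_zero d)))).resolve_left hf1
  · intro j _
    have h2 := h _ (prod_mul_mem_equivFun (χ := χ) Finset.univ (fun k => hx (j k)) hf)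
    have h3 := congrArg (SmoothFun.eval E 1) h2
    rw [map_add, LinearMap.add_apply, map_add,
      lam_apply_one_of_mem_degLT hR (F := fun k => x (j k)) (fun k => hx1 _), add_zero,
      map_zero] at h3
    rw [h3, zero_smul]

include h𝔪 in
/-- `λ(P)` acts faithfully on `C^∞_{H,χ}(G)` for `P ∈ S(𝔪)`. -/
theorem eq_zero_of_lam_annihilates {P : SymC (LieAlg E G)} (hP : P ∈ SymC.sub 𝔪)
    (h : ∀ f ∈ EquivFun (E := E) H χ, lam E G P f = 0) : P = 0 := by
  obtain ⟨N, hN⟩ := exists_mem_degLT hP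
  clear hP
  induction N with
  | zero => simpa [degLT_zero] using hN
  | succ d ih =>
    obtain ⟨Q, hQ, R, hR, rfl⟩ := exists_add_of_mem_degLT_succ hN
    obtain rfl : Q = 0 := eq_zero_of_lam_add_annihilates hH hχ h𝔪 hQ hR h
    rw [zero_add] at ih ⊢
    exact ih hR

include h𝔪 in
/-- `𝔻(G)𝔥^χ` contains all the operators in `𝔻(G)` that annihilate `C^∞_{H,χ}(G)`. -/
theorem mem_leftIdealChi_of_annihilates {D : Op E G} (hD : D ∈ InvDiffOp E G)
    (h : ∀ f ∈ EquivFun (E := E) H χ, D f = 0) : D ∈ leftIdealChi H χ := by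
  obtain ⟨N, hN⟩ := exists_mem_wordSpan hD
  obtain ⟨_, ⟨P, hP, rfl⟩, D', hD', rfl⟩ := Submodule.mem_sup.1 (wordSpan_le_sup hH hχ h𝔪 N hN)
  have hP0 : P = 0 := eq_zero_of_lam_annihilates hH hχ h𝔪 (degLT_le_sub 𝔪 N hP) fun f hf => by
    have h1 := h f hf
    rwa [LinearMap.add_apply, leftIdealChi_apply_eq_zero hD' hf, add_zero] at h1
  rw [hP0, map_zero, zero_add]
  exact hD'

omit hH hχ in
theorem adOp_annihilates {D : Op E G} (hD : ∀ f ∈ EquivFun (E := E) H χ, D f = 0) {h : G}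
    (hh : h ∈ H) {f : SmoothFun E G} (hf : f ∈ EquivFun H χ) : adOp h D f = 0 := by
  have h1 : rightTranslate h⁻¹ f = ((χ (⟨h, hh⟩ : H) : ℂˣ) : ℂ) • f := by
    refine SmoothFun.ext' fun g => ?_
    have h2 := hf g (⟨h, hh⟩ : H)⁻¹
    rw [inv_inv] at h2
    refine h2.trans (mul_comm _ _)
  change rightTranslate h (D (rightTranslate h⁻¹ f)) = 0
  rw [h1, map_smul, hD f hf, smul_zero, map_zero]

include h𝔪 in
/-- If `λ(P) ∈ 𝔻_{H,χ,mod}(G)`, where `P ∈ S(𝔪)`, then the leading term of `P` lies in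
`I_mod(𝔪)`. -/
theorem homog_mem_IMod {d : ℕ} {Q R : SymC (LieAlg E G)} (hQ : Q ∈ homog 𝔪 d)
    (hR : R ∈ degLT 𝔪 d) (h : lam E G (Q + R) ∈ DMod H χ) : Q ∈ IMod H 𝔪 h𝔪 := by
  refine ⟨homog_le_sub 𝔪 d hQ, fun g hg => ?_⟩
  set σ := 𝔪.projection (lieSubalg H) h𝔪
  have hAdQ : SymC.map (Ad g) Q ∈ homog ⊤ d := map_mem_homog (fun _ _ => Submodule.mem_top) hQ
  have hσ : SymC.map σ (SymC.map (Ad g) Q) ∈ homog 𝔪 d :=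
    map_mem_homog (fun v _ => Submodule.projection_apply_mem h𝔪 v) hAdQ
  have h1 := lam_sub_lam_map_projection_mem hH hχ h𝔪 hAdQ
  have hRw : lam E G R ∈ wordSpan E G d :=
    map_lam_degLT_le_wordSpan 𝔪 d (Submodule.mem_map_of_mem hR)
  have h2 := wordSpan_le_sup hH hχ h𝔪 d (adOp_mem_wordSpan g hRw)
  have h3 := wordSpan_le_sup hH hχ h𝔪 d hRw
  have h4 := Submodule.mem_sup_right (S := (degLT 𝔪 d).map (lam E G)) (h.2 g hg)
  have h5 : lam E G (SymC.map σ (SymC.map (Ad g) Q) - Q) ∈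
      (degLT 𝔪 d).map (lam E G) ⊔ leftIdealChi H χ := by
    have h6 := sub_mem (add_mem h4 h3) (add_mem h1 h2)
    rw [map_add, map_add, adOp_lam hQ] at h6
    rw [map_sub]
    convert h6 using 1
    abel
  obtain ⟨_, ⟨R', hR', rfl⟩, D', hD', hsum⟩ := Submodule.mem_sup.1 h5
  refine sub_eq_zero.1 (eq_zero_of_lam_add_annihilates hH hχ h𝔪 (sub_mem hσ hQ)
    (neg_mem hR') fun f hf => ?_)
  rw [map_add, ← hsum, map_neg, add_neg_cancel_comm]
  exact leftIdealChi_apply_eq_zero hD' hf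

end Reduction

/-! ### Invariant operators on the equivariant functions -/

theorem proposition2p8 {E : Type*} [NormedAddCommGroup E] [NormedSpace ℝ E]
    [FiniteDimensional ℝ E] {G : Type*} [TopologicalSpace G] [T2Space G] [ChartedSpace E G]
    [Group G] [LieGroup 𝓘(ℝ, E) ∞ G]
    (H : Subgroup G) (hH : IsClosed (H : Set G))
    (𝔪 : Submodule ℝ (LieAlg E G)) (h𝔪 : IsCompl 𝔪 (lieSubalg H))
    (χ : H →* ℂˣ) (hχ : Continuous χ)
    (hmod : (IMod H 𝔪 h𝔪).toSubmodule.map (lam E G) ≤ DMod H χ) :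
    (IMod H 𝔪 h𝔪).toSubmodule.map (lam E G) =
        (SymC.sub 𝔪).toSubmodule.map (lam E G) ⊓ DMod H χ ∧
      ∃ e : (IMod H 𝔪 h𝔪).toSubmodule.map (lam E G) ≃ₗ[ℂ] (DMod H χ).map (restrictOp H χ),
        ∀ D, (e D).1 = restrictOp H χ D.1 := by
  -- Induction on the degree: by `hmod` the leading term can be subtracted.
  have key : ∀ N, ∀ P ∈ degLT 𝔪 N, lam E G P ∈ DMod H χ → P ∈ IMod H 𝔪 h𝔪 := by
    intro N
    induction N with
    | zero =>
      intro P hP _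
      rw [degLT_zero, Submodule.mem_bot] at hP
      rw [hP]
      exact zero_mem _
    | succ d ih =>
      intro P hP hD
      obtain ⟨Q, hQ, R, hR, rfl⟩ := exists_add_of_mem_degLT_succ hP
      have hQI := homog_mem_IMod hH hχ h𝔪 hQ hR hD
      refine add_mem hQI (ih R hR ?_)
      have h1 := sub_mem hD (hmod (Submodule.mem_map_of_mem hQI))
      rwa [map_add, add_sub_cancel_left] at h1
  have hle : (IMod H 𝔪 h𝔪).toSubmodule ≤ (SymC.sub 𝔪).toSubmodule := fun P hP => hP.1
  have heq : (IMod H 𝔪 h𝔪).toSubmodule.map (lam E G) =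
      (SymC.sub 𝔪).toSubmodule.map (lam E G) ⊓ DMod H χ := by
    refine le_antisymm (le_inf (Submodule.map_mono hle) hmod) ?_
    rintro _ ⟨⟨P, hP, rfl⟩, hD⟩
    obtain ⟨N, hN⟩ := exists_mem_degLT hP
    exact Submodule.mem_map_of_mem (key N P hN hD)
  refine ⟨heq, ?_⟩
  let T : (IMod H 𝔪 h𝔪).toSubmodule.map (lam E G) →ₗ[ℂ] (DMod H χ).map (restrictOp H χ) :=
    (restrictOp H χ).restrict fun D hD => Submodule.mem_map_of_mem (hmod hD)
  have hT : Function.Bijective T := by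
    constructor
    · rw [injective_iff_map_eq_zero]
      rintro ⟨_, P, hP, rfl⟩ h0
      have h1 : restrictOp H χ (lam E G P) = 0 := congrArg Subtype.val h0
      have hP0 := eq_zero_of_lam_annihilates hH hχ h𝔪 (hle hP) fun f hf =>
        congrArg (fun S : EquivFun (E := E) H χ →ₗ[ℂ] SmoothFun E G => S ⟨f, hf⟩) h1
      refine Subtype.ext ?_
      change lam E G P = 0
      rw [hP0, map_zero]
    · rintro ⟨_, D, hD, rfl⟩
      obtain ⟨N, hN⟩ := exists_mem_wordSpan hD.1
      obtain ⟨_, ⟨P, hP, rfl⟩, D', hD', rfl⟩ :=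
        Submodule.mem_sup.1 (wordSpan_le_sup hH hχ h𝔪 N hN)
      have hPs : P ∈ SymC.sub 𝔪 := degLT_le_sub 𝔪 N hP
      have hDI : D' ∈ InvDiffOp E G := by
        have h1 := sub_mem hD.1 (lam_mem_invDiffOp hPs)
        rwa [add_sub_cancel_left] at h1
      -- An operator of `𝔻(G)𝔥^χ` lies in `𝔻_{H,χ,mod}(G)`, as its conjugates annihilate too.
      have hD'm : D' ∈ DMod H χ := by
        refine ⟨hDI, fun h hh => mem_leftIdealChi_of_annihilates hH hχ h𝔪
          (sub_mem (adOp_mem_invDiffOp h hDI) hDI) fun f hf => ?_⟩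
        have h0 := fun f (hf : f ∈ EquivFun (E := E) H χ) => leftIdealChi_apply_eq_zero hD' hf
        rw [LinearMap.sub_apply, h0 f hf, adOp_annihilates h0 hh hf, sub_zero]
      have hPm : lam E G P ∈ DMod H χ := by
        have h1 := sub_mem hD hD'm
        rwa [add_sub_cancel_right] at h1
      refine ⟨⟨lam E G P, Submodule.mem_map_of_mem (key N P hP hPm)⟩, Subtype.ext ?_⟩
      change restrictOp H χ (lam E G P) = restrictOp H χ (lam E G P + D')
      rw [map_add]
      refine (add_eq_left.2 (LinearMap.ext fun f => ?_)).symm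
      exact leftIdealChi_apply_eq_zero hD' f.2
  exact ⟨LinearEquiv.ofBijective T hT, fun D => rfl⟩
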